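/- Let $\{S_i\}_{i\in\mathcal I}$ be a finite family, $|\mathcal I|\ge 2$, of maps of the plane of the form $S_i = T_i\circ L_i + t_i$, where $T_i=\mathrm{diag}(a_i,b_i)$ with $a_i,b_i\in(0,1)$, $L_i$ is a linear isometry of $\mathbb R^2$ with $L_i([-1,1]^2)=[-1,1]^2$, and $t_i\in\mathbb R^2$. Let $F$ be its attractor (a box-like self-affine set), i.e. the unique non-empty compact set with $F=\bigcup_{i\in\mathcal I}S_i(F)$. Write $\alpha_1(i)\ge\alpha_2(i)$ for the singular values of the linear part of $S_i$. Assume: (a) (separated type) no $S_i$ maps horizontal lines to vertical lines; (b) (rectangular open set condition) there is a non-empty open rectangle $R=(a,b)\times(c,d)$ such that the sets $S_i(R)$, $i\in\mathcal I$, are pairwise disjoint subsets of $R$; (c) for each $i$, the larger singular value $\alpha_1(i)$ is the factor by which $S_i$ contracts in the horizontal direction. Let $\pi_1(x,y)=x$. Then the box-counting dimension $s_1=\dim_{\mathrm B}\pi_1(F)$ exists, the equation $$\sum_{i\in\mathcal I}\alpha_1(i)^{s_1}\,\alpha_2(i)^{s-s_1}=1$$ has a unique real solution $s$, this solution satisfies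 $s \ge 0$, and the box-counting dimension of $F$ exists with $$\dim_{\mathrm P}F=\dim_{\mathrm B}F=s ,$$ where $\dim_{\mathrm P}$ is packing dimension (defined through packing measures). Furthermore, if $s_1=1$, then $s$ is the affinity dimension of $F$, i.e. $$s=\inf\Big\{t\ge 0:\ \sum_{k=1}^\infty\ \sum_{(i_1,\dots,i_k)\in\mathcal I^k}\phi^t(A_{i_1}\circ\cdots\circ A_{i_k})<\infty\Big\},$$ where $A_i=T_i\circ L_i$ and, for a linear map $A$ of the plane with singular values $\alpha_1\ge\alpha_2$, $\phi^t(A)=\alpha_1^t$ for $0\le t\le 1$, $\phi^t(A)=\alpha_1\alpha_2^{t-1}$ for $1<t\le 2$, and $\phi^t(A)=(\alpha_1\alpha_2)^{t/2}$ for $t>2$. -/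

import Mathlib

open Set Filter Topology
open scoped ENNReal NNReal

namespace BoxLike

noncomputable section

/-- The Euclidean plane. -/
abbrev Plane : Type := EuclideanSpace ℝ (Fin 2)

/-! ### Box-counting dimension -/

/-- The smallest number of sets of diameter at most `δ` needed to cover `A`
(meaningful for totally bounded `A` and `δ > 0`). -/
def coverNumber {X : Type*} [PseudoEMetricSpace X] (δ : ℝ) (A : Set X) : ℕ :=
  sInf {n : ℕ | ∃ U : Fin n → Set X,
    (∀ j, Metric.ediam (U j) ≤ ENNReal.ofReal δ) ∧ A ⊆ ⋃ j, U j}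

/-- Lower box-counting dimension of a bounded set. -/
def lowerBoxDim {X : Type*} [PseudoEMetricSpace X] (A : Set X) : EReal :=
  liminf (fun δ : ℝ => ((Real.log (coverNumber δ A) / -Real.log δ : ℝ) : EReal)) (𝓝[>] 0)

/-- Upper box-counting dimension of a bounded set. -/
def upperBoxDim {X : Type*} [PseudoEMetricSpace X] (A : Set X) : EReal :=
  limsup (fun δ : ℝ => ((Real.log (coverNumber δ A) / -Real.log δ : ℝ) : EReal)) (𝓝[>] 0)

/-- The box-counting dimension of `A` exists and equals `s`. -/
def HasBoxDim {X : Type*} [PseudoEMetricSpace X] (A : Set X) (s : ℝ) : Prop :=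
  lowerBoxDim A = (s : EReal) ∧ upperBoxDim A = (s : EReal)

/-! ### Packing measure and packing dimension -/

/-- `P` (a set of pairs (centre, radius)) is a `δ`-packing of `A`: the closed balls have centres in
`A` and radii in `(0, δ]`, and are pairwise disjoint. -/
def IsBallPacking {X : Type*} [PseudoMetricSpace X] (δ : ℝ) (A : Set X) (P : Set (X × ℝ)) : Prop :=
  P.Countable ∧ (∀ p ∈ P, p.1 ∈ A ∧ 0 < p.2 ∧ p.2 ≤ δ) ∧
    P.PairwiseDisjoint (fun p => Metric.closedBall p.1 p.2)

/-- The supremum of `∑ (2 r) ^ s` over all `δ`-packings of `A` by balls of radii `r`. -/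
def packingSup {X : Type*} [PseudoMetricSpace X] (s δ : ℝ) (A : Set X) : ℝ≥0∞ :=
  ⨆ (P : Set (X × ℝ)) (_ : IsBallPacking δ A P), ∑' p : P, ENNReal.ofReal ((2 * p.1.2) ^ s)

/-- The `s`-dimensional packing premeasure (the limit of `packingSup s δ A` as `δ` decreases
to `0`). -/
def packingPremeasure {X : Type*} [PseudoMetricSpace X] (s : ℝ) (A : Set X) : ℝ≥0∞ :=
  ⨅ (δ : ℝ) (_ : 0 < δ), packingSup s δ A

/-- The `s`-dimensional packing (outer) measure. -/
def packingMeasure {X : Type*} [PseudoMetricSpace X] (s : ℝ) (A : Set X) : ℝ≥0∞ :=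
  ⨅ (B : ℕ → Set X) (_ : A ⊆ ⋃ n, B n), ∑' n, packingPremeasure s (B n)

/-- The packing dimension: the supremum of the `s ≥ 0` with infinite `s`-dimensional packing
measure. -/
def packingDim {X : Type*} [PseudoMetricSpace X] (A : Set X) : ℝ≥0∞ :=
  ⨆ (s : ℝ≥0) (_ : packingMeasure (s : ℝ) A = ∞), (s : ℝ≥0∞)

/-! ### Singular values and affinity dimension -/

/-- The larger singular value. -/
def α₁ (A : Module.End ℝ Plane) : ℝ := LinearMap.singularValues A 0

/-- The smaller singular value. -/
def α₂ (A : Module.End ℝ Plane) : ℝ := LinearMap.singularValues A 1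

/-- The singular value function `φ^s` in the plane, with the usual extension `|det A| ^ (s / 2)`
for `s > 2`. -/
def singularValueFunction (s : ℝ) (A : Module.End ℝ Plane) : ℝ :=
  if s ≤ 1 then α₁ A ^ s
  else if s ≤ 2 then α₁ A * α₂ A ^ (s - 1)
  else (α₁ A * α₂ A) ^ (s / 2)

/-- The composition `A_{w₀} ∘ A_{w₁} ∘ ⋯ ∘ A_{w_{k-1}}` along a word `w` of length `k`. -/
def wordProd {ι : Type*} (A : ι → Module.End ℝ Plane) {k : ℕ} (w : Fin k → ι) :
    Module.End ℝ Plane :=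
  (List.ofFn fun j => A (w j)).prod

/-- The affinity dimension: the infimum of the `s ≥ 0` for which `φ^s` is summable over all finite
nonempty words. -/
def affinityDim {ι : Type*} [Fintype ι] (A : ι → Module.End ℝ Plane) : ℝ≥0∞ :=
  ⨅ (s : ℝ≥0) (_ : ∑' k : ℕ, ∑ w : Fin (k + 1) → ι,
    ENNReal.ofReal (singularValueFunction s (wordProd A w)) < ∞), (s : ℝ≥0∞)

/-! ### Box-like self-affine sets -/

/-- The square `[-1, 1]²`. -/
def centredSquare : Set Plane := {p | p 0 ∈ Icc (-1) 1 ∧ p 1 ∈ Icc (-1) 1}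

/-- Maps of the form `T ∘ L + t`, with `T = diag(a, b)`, `a, b ∈ (0, 1)`, and `L` a linear isometry
preserving `[-1, 1]²`. -/
def IsBoxLikeMap (S : Plane →ᵃ[ℝ] Plane) : Prop :=
  ∃ a ∈ Ioo (0 : ℝ) 1, ∃ b ∈ Ioo (0 : ℝ) 1, ∃ (L : Plane ≃ₗᵢ[ℝ] Plane) (t : Plane),
    L '' centredSquare = centredSquare ∧ ∀ p : Plane, S p = !₂[a * L p 0, b * L p 1] + t

/-- `F` is the attractor of the iterated function system `S`. -/
def IsAttractor {ι : Type*} (S : ι → Plane →ᵃ[ℝ] Plane) (F : Set Plane) : Prop :=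
  F.Nonempty ∧ IsCompact F ∧ F = ⋃ i, S i '' F

def IsHorizontalLine (ℓ : Set Plane) : Prop := ∃ c : ℝ, ℓ = {p | p 1 = c}

def IsVerticalLine (ℓ : Set Plane) : Prop := ∃ c : ℝ, ℓ = {p | p 0 = c}

/-- No map of the system sends horizontal lines to vertical lines. -/
def IsSeparatedType {ι : Type*} (S : ι → Plane →ᵃ[ℝ] Plane) : Prop :=
  {i | ∀ ℓ, IsHorizontalLine ℓ → IsVerticalLine (S i '' ℓ)} = ∅

/-- The open rectangle `(a, b) × (c, d)`. -/
def openRectangle (a b c d : ℝ) : Set Plane := {p | p 0 ∈ Ioo a b ∧ p 1 ∈ Ioo c d}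

/-- The rectangular open set condition. -/
def ROSC {ι : Type*} (S : ι → Plane →ᵃ[ℝ] Plane) : Prop :=
  ∃ a b c d : ℝ, (openRectangle a b c d).Nonempty ∧
    (∀ i, S i '' openRectangle a b c d ⊆ openRectangle a b c d) ∧
    Pairwise fun i j => Disjoint (S i '' openRectangle a b c d) (S j '' openRectangle a b c d)

/-- The larger singular value of `A` is the factor by which `A` contracts horizontal vectors. -/
def LargerSingularValueHorizontal (A : Module.End ℝ Plane) : Prop :=
  ∀ x : ℝ, ‖A !₂[x, 0]‖ = α₁ A * |x|

/-- Projection onto the horizontal axis. -/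
def π₁ (p : Plane) : ℝ := p 0

end

end BoxLike

/-!
The proof counts separated points. A set `A` is said to satisfy `HasSepDim A s` when, for every
`ε > 0` and all scales `δ ≤ 1`, every `δ`-separated finite subset of `A` has at most
`C δ ^ (-(s + ε))` points and some `δ`-separated subset has at least `c δ ^ (-(s - ε))` points.
This implies that the box-counting dimension of `A` exists and equals `s`
(`HasSepDim.hasBoxDim`).

Separated type forces every map to be diagonal, `(x, y) ↦ (a x + u, b y + v)`
(`IsBoxLikeMap.exists_eq_diagMap`), and the assumption on singular values gives `|b| ≤ |a|`. The
projection `π₁ F` is then a self-similar subset of the line, possibly with overlaps. The number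
`N(δ)` of separated points of such a set satisfies `N(κ δ r) ≥ N(δ) N(r)`, because a copy of an
`r`-separated set fits into a small cylinder around each point of a `δ`-separated set. Hence, if
`N(δ) > (κ δ) ^ (-t)` at a single scale, then `N` grows like `r ^ (-t)` at all scales, and the growth
exponent `s₁` exists (`exists_hasSepDim_of_selfSimilar`).

For `F` itself, consider a copy `g F` under any diagonal map `g` with coefficients `|B| ≤ |A|`. If
`|B|` is comparable to `δ`, then at scale `δ` the copy cannot be distinguished from its projection,
and so it carries about `(|A| / δ) ^ s₁` separated points, which is comparable to
`|A| ^ s₁ |B| ^ (s - s₁) δ ^ (-s)`. If `|B|` is larger, then `g F` is split into the copies `g Sᵢ F`.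
The equation for `s` says exactly that the quantity `|A| ^ s₁ |B| ^ (s - s₁)` is preserved when it is
summed over these copies, so induction gives the same estimate for `F`. Upper bounds are
subadditive without any separation (`IsDiagonalAttractor.card_le_image`). For lower bounds the points
are moved slightly so that balls of radius proportional to `δ` around them lie inside the open
rectangles `g R`; the disjointness of these rectangles then keeps points of different copies apart
(`IsDiagonalAttractor.exists_isInnerNet`).

The packing dimension is at most the growth exponent by a sum over dyadic radii. It is at least the
growth exponent because, by Baire's theorem, some piece of any countable cover of `F` is dense in a
small affine copy of `F`. Finally, the singular value function is multiplicative on words of diagonal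
maps with a common dominating direction, so the series which defines the affinity dimension is
geometric. For `s₁ = 1` one has `1 ≤ s`, because a projection does not increase dimension, and
`s ≤ 2`, by comparison of areas; in this range the ratio of the series is less than `1` exactly for
`t > s`.
-/

namespace BoxLike

/-! ### Separated sets and box-counting dimension -/

section Separated

variable {X : Type*} [PseudoMetricSpace X]

/-- A finite set whose distinct points are at distance more than `r` from each other. -/
def Separated (r : ℝ) (Q : Finset X) : Prop :=
  (Q : Set X).Pairwise fun x y => r < dist x y

/-- The growth of the cardinality of separated subsets of `A` is governed by the exponent `s`, up
to arbitrarily small errors in the exponent, uniformly in all scales `δ ≤ 1`. -/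
structure HasSepDim (A : Set X) (s : ℝ) : Prop where
  upper : ∀ ε > 0, ∃ C > 0, ∀ δ, 0 < δ → δ ≤ 1 → ∀ Q : Finset X, ↑Q ⊆ A → Separated δ Q →
    (Q.card : ℝ) ≤ C * δ ^ (-(s + ε))
  lower : ∀ ε > 0, ∃ c > 0, ∀ δ, 0 < δ → δ ≤ 1 → ∃ Q : Finset X, ↑Q ⊆ A ∧ Separated δ Q ∧
    c * δ ^ (-(s - ε)) ≤ (Q.card : ℝ)

lemma Separated.mono {r r' : ℝ} {Q Q' : Finset X} (h : Separated r Q) (hr : r' ≤ r)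
    (hQ : Q' ⊆ Q) : Separated r' Q' :=
  fun _ hx _ hy hxy => hr.trans_lt (h (hQ hx) (hQ hy) hxy)

/-- An `r`-separated set of maximal cardinality is an `r`-net. -/
lemma exists_maximal_separated {A : Set X} {r : ℝ} (hr : 0 ≤ r) {N : ℝ}
    (hN : ∀ Q : Finset X, ↑Q ⊆ A → Separated r Q → (Q.card : ℝ) ≤ N) :
    ∃ Q : Finset X, ↑Q ⊆ A ∧ Separated r Q ∧ ∀ a ∈ A, ∃ q ∈ Q, dist a q ≤ r := by
  classical
  let T : Set ℕ := {n | ∃ Q : Finset X, ↑Q ⊆ A ∧ Separated r Q ∧ Q.card = n}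
  have hT0 : T.Nonempty := ⟨0, ∅, by simp, by simp [Separated], rfl⟩
  have hTb : BddAbove T := by
    refine ⟨⌊N⌋₊, ?_⟩
    rintro n ⟨Q, h1, h2, rfl⟩
    exact Nat.le_floor (hN Q h1 h2)
  obtain ⟨Q, h1, h2, h3⟩ := Nat.sSup_mem hT0 hTb
  refine ⟨Q, h1, h2, fun a ha => ?_⟩
  by_contra! hcon
  have haQ : a ∉ Q := fun h => by
    have := hcon a h
    rw [dist_self] at this
    linarith
  have : (insert a Q).card ∈ T := by
    refine ⟨insert a Q, ?_, ?_, rfl⟩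
    · rw [Finset.coe_insert]
      exact insert_subset ha h1
    · rw [Separated, Finset.coe_insert]
      refine h2.insert fun b hb _ => ⟨hcon b hb, ?_⟩
      rw [dist_comm]
      exact hcon b hb
  have h4 := le_csSup hTb this
  rw [Finset.card_insert_of_notMem haQ, ← h3] at h4
  omega

lemma coverNumber_le {A : Set X} {δ : ℝ} {κ : Type*} [Fintype κ] (U : κ → Set X)
    (hU : ∀ j, Metric.ediam (U j) ≤ ENNReal.ofReal δ) (hA : A ⊆ ⋃ j, U j) :
    coverNumber δ A ≤ Fintype.card κ := by
  refine Nat.sInf_le ⟨fun j => U ((Fintype.equivFin κ).symm j), fun j => hU _, ?_⟩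
  refine hA.trans fun x hx => ?_
  obtain ⟨j, hj⟩ := mem_iUnion.1 hx
  exact mem_iUnion.2 ⟨Fintype.equivFin κ j, by simpa using hj⟩

/-- A maximal `r`-separated set gives a cover by closed balls of radius `r`. -/
lemma coverNumber_le_of_net {A : Set X} {r : ℝ} {Q : Finset X}
    (hQ : ∀ a ∈ A, ∃ q ∈ Q, dist a q ≤ r) : coverNumber (2 * r) A ≤ Q.card := by
  have := coverNumber_le (A := A) (δ := 2 * r) (κ := Q)
    (fun q => {a | a ∈ A ∧ dist a q ≤ r}) (fun q => ?_) (fun a ha => ?_)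
  · simpa using this
  · refine Metric.ediam_le fun x hx y hy => ?_
    rw [edist_dist]
    refine ENNReal.ofReal_le_ofReal ?_
    have := dist_triangle_right x y (q : X)
    linarith [hx.2, hy.2]
  · obtain ⟨q, hq, h⟩ := hQ a ha
    exact mem_iUnion.2 ⟨⟨q, hq⟩, ha, h⟩

/-- A set of diameter at most `r` contains at most one point of an `r`-separated set. -/
lemma card_le_coverNumber {A : Set X} {r : ℝ} {Q : Finset X} (hr : 0 ≤ r) (hQA : ↑Q ⊆ A)
    (hQ : Separated r Q) {n : ℕ} {U : Fin n → Set X}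
    (hU : ∀ j, Metric.ediam (U j) ≤ ENNReal.ofReal r) (hA : A ⊆ ⋃ j, U j) :
    Q.card ≤ coverNumber r A := by
  obtain ⟨V, hV, hAV⟩ := Nat.sInf_mem (s := {n : ℕ | ∃ U : Fin n → Set X,
    (∀ j, Metric.ediam (U j) ≤ ENNReal.ofReal r) ∧ A ⊆ ⋃ j, U j}) ⟨n, U, hU, hA⟩
  change Fin (coverNumber r A) → Set X at V
  have h : ∀ q : Q, ∃ j, (q : X) ∈ V j := fun q => mem_iUnion.1 (hAV (hQA q.2))
  choose f hf using h
  have hinj : Function.Injective f := by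
    intro p q hpq
    by_contra hne
    have h1 : r < dist (p : X) q := hQ p.2 q.2 (fun h => hne (Subtype.ext h))
    have h2 : edist (p : X) q ≤ ENNReal.ofReal r :=
      (Metric.edist_le_ediam_of_mem (hf p) (hpq ▸ hf q)).trans (hV _)
    rw [edist_dist, ENNReal.ofReal_le_ofReal_iff hr] at h2
    linarith
  simpa using Fintype.card_le_of_injective f hinj

lemma HasSepDim.log_coverNumber_le {A : Set X} {s : ℝ} (h : HasSepDim A s) {ε : ℝ} (hε : 0 < ε) :
    ∃ K : ℝ, ∀ δ, 0 < δ → δ ≤ 1 → A.Nonempty →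
      Real.log (coverNumber δ A) ≤ K + (s + ε) * (-Real.log δ) := by
  obtain ⟨C, hC, hU⟩ := h.upper ε hε
  refine ⟨Real.log C + (s + ε) * Real.log 2, fun δ h0 h1 hA => ?_⟩
  obtain ⟨Q, hQA, hQ, hnet⟩ := exists_maximal_separated (by positivity)
    (hU (δ / 2) (by positivity) (by linarith))
  have hcov := coverNumber_le_of_net hnet
  rw [mul_div_cancel₀ _ (two_ne_zero)] at hcov
  have hcard := hU (δ / 2) (by positivity) (by linarith) Q hQA hQ
  have hQpos : 0 < Q.card := by
    obtain ⟨a, ha⟩ := hA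
    obtain ⟨q, hq, -⟩ := hnet a ha
    exact Finset.card_pos.2 ⟨q, hq⟩
  have hle : Real.log (coverNumber δ A) ≤ Real.log (Q.card : ℝ) := by
    rcases Nat.eq_zero_or_pos (coverNumber δ A) with h0 | h0
    · rw [h0]
      simpa using Real.log_nonneg (by exact_mod_cast hQpos)
    · exact Real.log_le_log (by exact_mod_cast h0) (by exact_mod_cast hcov)
  refine hle.trans ((Real.log_le_log (by exact_mod_cast hQpos) hcard).trans ?_)
  rw [Real.log_mul hC.ne' (by positivity), Real.log_rpow (by positivity),
    Real.log_div h0.ne' two_ne_zero]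
  linarith

lemma HasSepDim.le_log_coverNumber {A : Set X} {s : ℝ} (h : HasSepDim A s) {ε : ℝ} (hε : 0 < ε) :
    ∃ K : ℝ, ∀ δ, 0 < δ → δ ≤ 1 →
      K + (s - ε) * (-Real.log δ) ≤ Real.log (coverNumber δ A) := by
  obtain ⟨C, hC, hU⟩ := h.upper ε hε
  obtain ⟨c, hc, hL⟩ := h.lower ε hε
  refine ⟨Real.log c, fun δ h0 h1 => ?_⟩
  obtain ⟨M, hMA, hM, hnet⟩ := exists_maximal_separated (by positivity)
    (hU (δ / 2) (by positivity) (by linarith))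
  obtain ⟨Q, hQA, hQ, hcard⟩ := hL δ h0 h1
  have hle : Q.card ≤ coverNumber δ A := by
    refine card_le_coverNumber h0.le hQA hQ
      (U := fun j => Metric.closedBall ((M.equivFin.symm j : M) : X) (δ / 2)) (fun j => ?_)
      (fun a ha => ?_)
    · refine Metric.ediam_le fun x hx y hy => ?_
      rw [edist_dist]
      refine ENNReal.ofReal_le_ofReal ?_
      have := dist_triangle_right x y ((M.equivFin.symm j : M) : X)
      rw [Metric.mem_closedBall] at hx hy
      linarith
    · obtain ⟨q, hq, h⟩ := hnet a ha
      refine mem_iUnion.2 ⟨M.equivFin ⟨q, hq⟩, ?_⟩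
      simpa using h
  have h2 : c * δ ^ (-(s - ε)) ≤ (coverNumber δ A : ℝ) := hcard.trans (by exact_mod_cast hle)
  have h3 := Real.log_le_log (by positivity) h2
  rw [Real.log_mul hc.ne' (by positivity), Real.log_rpow (by positivity)] at h3
  linarith

theorem HasSepDim.hasBoxDim {A : Set X} {s : ℝ} (h : HasSepDim A s) (hA : A.Nonempty) :
    HasBoxDim A s := by
  have hlog : Tendsto (fun δ : ℝ => -Real.log δ) (𝓝[>] 0) atTop :=
    tendsto_neg_atBot_atTop.comp Real.tendsto_log_nhdsGT_zero
  have key : Tendsto (fun δ : ℝ => Real.log (coverNumber δ A) / -Real.log δ) (𝓝[>] 0) (𝓝 s) := by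
    rw [Metric.tendsto_nhds]
    intro ε hε
    obtain ⟨K, hK⟩ := h.log_coverNumber_le (half_pos hε)
    obtain ⟨K', hK'⟩ := h.le_log_coverNumber (half_pos hε)
    filter_upwards [Ioc_mem_nhdsGT (zero_lt_one' ℝ), hlog.eventually_gt_atTop 0,
      hlog.eventually_gt_atTop (K / (ε / 2)), hlog.eventually_gt_atTop (-K' / (ε / 2))]
      with δ hδ hL0 hL1 hL2
    have h1 := hK δ hδ.1 hδ.2 hA
    have h2 := hK' δ hδ.1 hδ.2
    rw [div_lt_iff₀ (by positivity)] at hL1 hL2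
    rw [Real.dist_eq, abs_lt, lt_sub_iff_add_lt, sub_lt_iff_lt_add, lt_div_iff₀ hL0,
      div_lt_iff₀ hL0]
    constructor <;> nlinarith
  have key' : Tendsto (fun δ : ℝ => ((Real.log (coverNumber δ A) / -Real.log δ : ℝ) : EReal))
      (𝓝[>] 0) (𝓝 (s : EReal)) := (continuous_coe_real_ereal.tendsto s).comp key
  exact ⟨key'.liminf_eq, key'.limsup_eq⟩

end Separated

/-! ### Self-similar sets with overlaps -/

section SelfSimilar

/-- A family of points indexed by `S` which is `r`-separated is injective on `S`, so its image has
the same cardinality. -/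
lemma exists_separated_image {X κ : Type*} [PseudoMetricSpace X] {r : ℝ} (hr : 0 ≤ r)
    {S : Finset κ} {f : κ → X} (h : (S : Set κ).Pairwise fun a b => r < dist (f a) (f b)) :
    ∃ Q : Finset X, (Q : Set X) = f '' S ∧ Separated r Q ∧ Q.card = S.card := by
  classical
  refine ⟨S.image f, by simp, ?_, Finset.card_image_of_injOn ?_⟩
  · rw [Separated, Finset.coe_image]
    rintro _ ⟨a, ha, rfl⟩ _ ⟨b, hb, rfl⟩ hab
    exact h ha hb fun h' => hab (h' ▸ rfl)
  · intro a ha b hb hab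
    by_contra hne
    have : r < dist (f a) (f b) := h ha hb hne
    rw [hab, dist_self] at this
    linarith

variable {X ι : Type*} [PseudoMetricSpace X] {f : ι → X → X} {c : ι → ℝ} {E : Set X}

/-- Every point of a self-similar set lies in a cylinder whose ratio is comparable to a prescribed
scale `δ`. -/
lemma exists_similarity (hc0 : ∀ i, 0 < c i) {m M : ℝ} (hm : ∀ i, m ≤ c i)
    (hM : ∀ i, c i ≤ M) (hM1 : M < 1) (hm0 : 0 < m) (hm1 : m ≤ 1)
    (hf : ∀ i x y, dist (f i x) (f i y) = c i * dist x y) (hE : E = ⋃ i, f i '' E)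
    {δ : ℝ} (h0 : 0 < δ) (h1 : δ ≤ 1) {x : X} (hx : x ∈ E) :
    ∃ (g : X → X) (ρ : ℝ), MapsTo g E E ∧ x ∈ g '' E ∧ m * δ ≤ ρ ∧ ρ ≤ δ ∧
      ∀ u v, dist (g u) (g v) = ρ * dist u v := by
  have hM0 : 0 < M := by
    rw [hE] at hx
    obtain ⟨i, -⟩ := mem_iUnion.1 hx
    exact (hc0 i).trans_le (hM i)
  obtain ⟨n, hn⟩ := exists_pow_lt_of_lt_one h0 hM1
  have main : ∀ (n : ℕ) (δ : ℝ) (x : X), x ∈ E → M ^ n ≤ δ → δ ≤ 1 →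
      ∃ (g : X → X) (ρ : ℝ), MapsTo g E E ∧ x ∈ g '' E ∧ m * δ ≤ ρ ∧ ρ ≤ δ ∧
      ∀ u v, dist (g u) (g v) = ρ * dist u v := by
    intro n
    induction n with
    | zero =>
      intro δ x hx h0 h1
      rw [pow_zero] at h0
      obtain rfl : δ = 1 := le_antisymm h1 h0
      exact ⟨id, 1, mapsTo_id _, ⟨x, hx, rfl⟩, by linarith, le_rfl, by simp⟩
    | succ n ih =>
      intro δ x hx h0 h1
      have hδ : 0 < δ := lt_of_lt_of_le (by positivity) h0
      have hx' := hx
      rw [hE] at hx'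
      obtain ⟨i, y, hy, rfl⟩ := mem_iUnion.1 hx'
      have hfE : MapsTo (f i) E E := fun z hz => by
        rw [hE]
        exact mem_iUnion.2 ⟨i, z, hz, rfl⟩
      have hci := hc0 i
      rcases le_or_gt δ (c i) with hle | hlt
      · obtain ⟨g, ρ, hg, ⟨z, hz, hgz⟩, h2, h3, h4⟩ := ih (δ / c i) y hy (by
          rw [le_div_iff₀ hci]
          calc M ^ n * c i ≤ M ^ n * M := by gcongr; exact hM i
            _ ≤ δ := by rw [← pow_succ]; exact h0) (by rwa [div_le_one hci])
        refine ⟨f i ∘ g, c i * ρ, hfE.comp hg, ⟨z, hz, by simp [hgz]⟩, ?_, ?_, fun u v => ?_⟩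
        · calc m * δ = c i * (m * (δ / c i)) := by field_simp
            _ ≤ _ := by gcongr
        · calc c i * ρ ≤ c i * (δ / c i) := by gcongr
            _ = δ := by field_simp
        · simp only [Function.comp, hf, h4, mul_assoc]
      · refine ⟨f i, c i, hfE, ⟨y, hy, rfl⟩, ?_, hlt.le, hf i⟩
        calc m * δ ≤ m * 1 := by gcongr
          _ ≤ c i := by rw [mul_one]; exact hm i
  exact main n δ x hx hn.le h1

/-- Supermultiplicativity of the number of separated points: a copy of an `r`-separated set is
placed in a cylinder of size comparable to `δ` around each point of a `δ`-separated set. -/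
lemma exists_supermultiplicative [Finite ι] [Nonempty ι] (hc : ∀ i, c i ∈ Ioo (0 : ℝ) 1)
    (hf : ∀ i x y, dist (f i x) (f i y) = c i * dist x y) (hE : E = ⋃ i, f i '' E)
    (hb : Bornology.IsBounded E) :
    ∃ κ : ℝ, 0 < κ ∧ κ < 1 ∧ ∀ δ r, 0 < δ → δ ≤ 1 → 0 < r → r ≤ 1 → ∀ Q R : Finset X,
      ↑Q ⊆ E → Separated δ Q → ↑R ⊆ E → Separated r R →
      ∃ P : Finset X, ↑P ⊆ E ∧ Separated (κ * δ * r) P ∧ P.card = Q.card * R.card := by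
  obtain ⟨i₀, hi₀⟩ := Finite.exists_min c
  obtain ⟨i₁, hi₁⟩ := Finite.exists_max c
  obtain ⟨D, hD⟩ := Metric.isBounded_iff.1 hb
  set D' := max D 0 with hD'
  have hD0 : 0 ≤ D' := le_max_right _ _
  have hm0 := (hc i₀).1
  have hm1 := (hc i₀).2
  refine ⟨c i₀ / (4 * (D' + 1)), by positivity, ?_, ?_⟩
  · rw [div_lt_one (by positivity)]
    linarith
  intro δ r hδ0 hδ1 hr0 hr1 Q R hQE hQ hRE hR
  -- Cylinders of ratio at most `η` have diameter at most `δ / 4`, so the cylinders around different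
  -- points of `Q` are more than `δ / 2` apart.
  set η := δ / (4 * (D' + 1)) with hη
  have hη0 : 0 < η := by positivity
  have hηδ : η * (4 * (D' + 1)) = δ := by rw [hη]; field_simp
  have hη1 : η ≤ 1 := by nlinarith
  have hκ : c i₀ / (4 * (D' + 1)) * δ = c i₀ * η := by rw [hη]; ring
  rw [hκ]
  have hcyl : ∀ q : X, ∃ (g : X → X) (ρ : ℝ), q ∈ E → (MapsTo g E E ∧ q ∈ g '' E ∧
      c i₀ * η ≤ ρ ∧ ρ ≤ η ∧ ∀ u v, dist (g u) (g v) = ρ * dist u v) := by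
    intro q
    by_cases hq : q ∈ E
    · obtain ⟨g, ρ, h⟩ := exists_similarity (fun i => (hc i).1) hi₀ hi₁ (hc i₁).2 hm0 hm1.le hf hE
        hη0 hη1 hq
      exact ⟨g, ρ, fun _ => h⟩
    · exact ⟨id, 0, fun h => absurd h hq⟩
  choose g ρ hg using hcyl
  have hnear : ∀ q ∈ E, ∀ u ∈ E, dist (g q u) q ≤ η * D' := by
    intro q hq u hu
    obtain ⟨-, ⟨z, hz, hzq⟩, -, h3, h4⟩ := hg q hq
    calc dist (g q u) q = ρ q * dist u z := by rw [← h4, hzq]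
      _ ≤ η * D' := by
        gcongr
        exact (hD hu hz).trans (le_max_left _ _)
  obtain ⟨P, hP1, hP2, hP3⟩ := exists_separated_image (r := c i₀ * η * r) (by positivity)
    (S := Q ×ˢ R) (f := fun p => g p.1 p.2) (by
      rintro ⟨q, u⟩ hqu ⟨q', u'⟩ hqu' hne
      simp only [Finset.coe_product, mem_prod, Finset.mem_coe] at hqu hqu'
      have hqE := hQE hqu.1
      have hqE' := hQE hqu'.1
      simp only
      by_cases hqq : q = q'
      · subst hqq
        obtain ⟨-, -, h2, -, h4⟩ := hg q hqE
        rw [h4]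
        have h5 : r < dist u u' := hR hqu.2 hqu'.2 fun h => hne (by rw [h])
        calc c i₀ * η * r ≤ ρ q * r := by gcongr
          _ < ρ q * dist u u' := by
            have : 0 < ρ q := lt_of_lt_of_le (by positivity) h2
            gcongr
      · have h5 : δ < dist q q' := hQ hqu.1 hqu'.1 hqq
        have h6 := hnear q hqE u (hRE hqu.2)
        have h7 := hnear q' hqE' u' (hRE hqu'.2)
        have h8 := dist_triangle4 q (g q u) (g q' u') q'
        rw [dist_comm q (g q u)] at h8
        have h9 : c i₀ * η * r ≤ η := by
          calc c i₀ * η * r ≤ 1 * η * 1 := by gcongr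
            _ = η := by ring
        nlinarith)
  refine ⟨P, ?_, hP2, by rw [hP3, Finset.card_product]⟩
  rw [hP1]
  rintro _ ⟨⟨q, u⟩, hqu, rfl⟩
  simp only [Finset.coe_product, mem_prod, Finset.mem_coe] at hqu
  exact (hg q (hQE hqu.1)).1 (hRE hqu.2)

/-- A self-similar set, without any separation condition, has a box-counting dimension: by
supermultiplicativity a single scale `δ` with more than `(κ δ) ^ (-t)` separated points forces
polynomial growth of order `t` at all scales. -/
theorem exists_hasSepDim_of_selfSimilar [Finite ι] [Nonempty ι] (hc : ∀ i, c i ∈ Ioo (0 : ℝ) 1)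
    (hf : ∀ i x y, dist (f i x) (f i y) = c i * dist x y) (hE : E = ⋃ i, f i '' E)
    (hb : Bornology.IsBounded E) (hne : E.Nonempty) {C₀ D₀ : ℝ}
    (hpoly : ∀ δ, 0 < δ → δ ≤ 1 → ∀ Q : Finset X, ↑Q ⊆ E → Separated δ Q →
      (Q.card : ℝ) ≤ C₀ * δ ^ (-D₀)) :
    ∃ s : ℝ, 0 ≤ s ∧ HasSepDim E s := by
  obtain ⟨κ, hκ0, hκ1, hmul⟩ := exists_supermultiplicative hc hf hE hb
  obtain ⟨x₀, hx₀⟩ := hne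
  let T : Set ℝ := {t | 0 ≤ t ∧ ∃ C > 0, ∀ r, 0 < r → r ≤ 1 →
    ∃ Q : Finset X, ↑Q ⊆ E ∧ Separated r Q ∧ C * r ^ (-t) ≤ (Q.card : ℝ)}
  have hT0 : (0 : ℝ) ∈ T :=
    ⟨le_rfl, 1, one_pos, fun r _ _ => ⟨{x₀}, by simpa using hx₀, by simp [Separated], by simp⟩⟩
  have hTb : BddAbove T := by
    refine ⟨D₀, ?_⟩
    rintro t ⟨-, C, hC, ht⟩
    by_contra! hlt
    have hlim : Tendsto (fun r : ℝ => r ^ (t - D₀)) (𝓝[>] 0) (𝓝 0) := by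
      have := (Real.continuousAt_rpow_const 0 (t - D₀) (Or.inr (by linarith))).tendsto
      rw [Real.zero_rpow (by linarith)] at this
      exact this.mono_left nhdsWithin_le_nhds
    have hC0 : 0 < C₀ := by
      obtain ⟨Q, h1, h2, h3⟩ := ht 1 one_pos le_rfl
      have := hpoly 1 one_pos le_rfl Q h1 h2
      rw [Real.one_rpow, mul_one] at this h3
      linarith
    obtain ⟨r, hr, hr'⟩ := ((hlim.eventually_lt_const (div_pos hC hC0)).and
      (Ioc_mem_nhdsGT (zero_lt_one' ℝ))).exists
    obtain ⟨Q, h1, h2, h3⟩ := ht r hr'.1 hr'.2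
    have h4 := h3.trans (hpoly r hr'.1 hr'.2 Q h1 h2)
    have hr0 := hr'.1
    rw [lt_div_iff₀ hC0] at hr
    have h5 : r ^ (-D₀) = r ^ (t - D₀) * r ^ (-t) := by
      rw [← Real.rpow_add hr0]
      ring_nf
    rw [h5, ← mul_assoc] at h4
    have := le_of_mul_le_mul_right h4 (by positivity)
    linarith
  have hs0 : 0 ≤ sSup T := le_csSup hTb hT0
  refine ⟨sSup T, hs0, ⟨fun ε hε => ?_, fun ε hε => ?_⟩⟩
  · set t := sSup T + ε with ht
    have ht0 : 0 < t := by linarith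
    refine ⟨κ ^ (-t), by positivity, fun δ h0 h1 Q hQE hQ => ?_⟩
    -- A violation at scale `δ` propagates to the scales `(κ δ) ^ k` and puts `t` into `T`.
    by_contra! hlt
    rw [← Real.mul_rpow hκ0.le h0.le] at hlt
    set σ := κ * δ with hσ
    have hσ0 : 0 < σ := by positivity
    have hσ1 : σ < 1 := by nlinarith
    have hpow : ∀ k : ℕ, ∃ P : Finset X, ↑P ⊆ E ∧ Separated (σ ^ k) P ∧
        (σ ^ k) ^ (-t) ≤ (P.card : ℝ) := by
      intro k
      induction k with
      | zero => exact ⟨{x₀}, by simpa using hx₀, by simp [Separated], by simp⟩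
      | succ k ih =>
        obtain ⟨P, hP1, hP2, hP3⟩ := ih
        obtain ⟨P', h1', h2', h3'⟩ := hmul δ (σ ^ k) h0 h1 (by positivity)
          (pow_le_one₀ hσ0.le hσ1.le) Q P hQE hQ hP1 hP2
        refine ⟨P', h1', by rwa [pow_succ'], ?_⟩
        rw [h3', pow_succ', Real.mul_rpow hσ0.le (by positivity)]
        rw [Nat.cast_mul]
        exact mul_le_mul hlt.le hP3 (by positivity) (Nat.cast_nonneg _)
    have : t ∈ T := by
      refine ⟨ht0.le, σ ^ t, by positivity, fun r hr0 hr1 => ?_⟩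
      obtain ⟨k, hk1, hk2⟩ := exists_nat_pow_near_of_lt_one hr0 hr1 hσ0 hσ1
      obtain ⟨P, hP1, hP2, hP3⟩ := hpow k
      refine ⟨P, hP1, hP2.mono hk2 subset_rfl, le_trans ?_ hP3⟩
      calc σ ^ t * r ^ (-t) = (σ⁻¹ * r) ^ (-t) := by
            rw [Real.mul_rpow (by positivity) hr0.le, Real.inv_rpow hσ0.le, Real.rpow_neg hσ0.le,
              inv_inv]
        _ ≤ (σ ^ k) ^ (-t) := by
          refine Real.rpow_le_rpow_of_nonpos (by positivity) ?_ (by linarith)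
          rw [← div_eq_inv_mul, le_div_iff₀ hσ0, ← pow_succ]
          exact hk1.le
    have := le_csSup hTb this
    linarith
  · obtain ⟨t, ⟨_, C, hC, hL⟩, htlt⟩ := exists_lt_of_lt_csSup ⟨0, hT0⟩
      (show sSup T - ε < sSup T by linarith)
    refine ⟨C, hC, fun δ h0 h1 => ?_⟩
    obtain ⟨Q, hQ1, hQ2, hQ3⟩ := hL δ h0 h1
    refine ⟨Q, hQ1, hQ2, le_trans ?_ hQ3⟩
    gcongr ?_ * ?_
    exact Real.rpow_le_rpow_of_exponent_ge h0 h1 (by linarith)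

/-- The number of points of a separated subset of a bounded interval is at most proportional to the
inverse of the separation. -/
lemma card_le_of_separated_real {E : Set ℝ} (hb : Bornology.IsBounded E) :
    ∃ C : ℝ, ∀ δ, 0 < δ → δ ≤ 1 → ∀ Q : Finset ℝ, ↑Q ⊆ E → Separated δ Q →
      (Q.card : ℝ) ≤ C * δ ^ (-1 : ℝ) := by
  classical
  obtain ⟨R, hR⟩ := hb.subset_closedBall 0
  refine ⟨2 * |R| + 2, fun δ h0 h1 Q hQE hQ => ?_⟩
  have hinj : (Q : Set ℝ).InjOn (fun x => ⌊x / δ⌋) := by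
    intro x hx y hy hxy
    by_contra hne
    have h2 := Int.abs_sub_lt_one_of_floor_eq_floor hxy
    have h3 : δ < dist x y := hQ hx hy hne
    rw [← sub_div, abs_div, abs_of_pos h0, div_lt_one h0] at h2
    rw [Real.dist_eq] at h3
    linarith
  have hsub : Q.image (fun x => ⌊x / δ⌋) ⊆ Finset.Icc ⌊-|R| / δ⌋ ⌊|R| / δ⌋ := by
    intro k hk
    obtain ⟨x, hx, rfl⟩ := Finset.mem_image.1 hk
    have h2 := hR (hQE hx)
    rw [mem_closedBall_zero_iff, Real.norm_eq_abs] at h2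
    have h3 := abs_le.1 (h2.trans (le_abs_self R))
    rw [Finset.mem_Icc]
    constructor <;> refine Int.floor_le_floor ?_ <;> gcongr <;> linarith
  have h4 := Finset.card_le_card hsub
  rw [Finset.card_image_of_injOn hinj, Int.card_Icc] at h4
  have hle : ⌊-|R| / δ⌋ ≤ ⌊|R| / δ⌋ := by
    refine Int.floor_le_floor ?_
    gcongr
    linarith [abs_nonneg R]
  have h5 : (Q.card : ℤ) ≤ ⌊|R| / δ⌋ + 1 - ⌊-|R| / δ⌋ := by omega
  have h6 : (Q.card : ℝ) ≤ (⌊|R| / δ⌋ : ℝ) + 1 - (⌊-|R| / δ⌋ : ℝ) := by exact_mod_cast h5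
  have h7 := Int.floor_le (|R| / δ)
  have h8 := Int.lt_floor_add_one (-|R| / δ)
  rw [neg_div] at h8 h6
  rw [Real.rpow_neg_one, ← div_eq_mul_inv]
  have h9 : (2 * |R| + 2) / δ = |R| / δ + |R| / δ + 2 * (1 / δ) := by ring
  have h10 : 1 ≤ 1 / δ := by rwa [one_le_div h0]
  linarith

end SelfSimilar

/-! ### Diagonal affine maps of the plane -/

/-- The diagonal affine map `(x, y) ↦ (A x + u, B y + v)`. -/
def diagMap (A B u v : ℝ) (p : Plane) : Plane := !₂[A * p 0 + u, B * p 1 + v]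

@[simp] lemma diagMap_zero (A B u v : ℝ) (p : Plane) : diagMap A B u v p 0 = A * p 0 + u := rfl

@[simp] lemma diagMap_one (A B u v : ℝ) (p : Plane) : diagMap A B u v p 1 = B * p 1 + v := rfl

lemma Plane.ext {p q : Plane} (h0 : p 0 = q 0) (h1 : p 1 = q 1) : p = q := by
  ext i
  fin_cases i
  · exact h0
  · exact h1

lemma diagMap_comp (A B u v A' B' u' v' : ℝ) (p : Plane) :
    diagMap A B u v (diagMap A' B' u' v' p) =
      diagMap (A * A') (B * B') (A * u' + u) (B * v' + v) p := by
  apply Plane.ext <;> simp <;> ring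

lemma diagMap_one_one (p : Plane) : diagMap 1 1 0 0 p = p := by
  apply Plane.ext <;> simp

lemma dist_sq_plane (p q : Plane) : dist p q ^ 2 = (p 0 - q 0) ^ 2 + (p 1 - q 1) ^ 2 := by
  rw [EuclideanSpace.dist_eq, Real.sq_sqrt (by positivity)]
  simp [Fin.sum_univ_two, Real.dist_eq, sq_abs]

lemma abs_sub_zero_le_dist (p q : Plane) : |p 0 - q 0| ≤ dist p q := by
  refine abs_le_of_sq_le_sq ?_ dist_nonneg
  rw [dist_sq_plane]
  nlinarith [sq_nonneg (p 1 - q 1)]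

lemma abs_sub_one_le_dist (p q : Plane) : |p 1 - q 1| ≤ dist p q := by
  refine abs_le_of_sq_le_sq ?_ dist_nonneg
  rw [dist_sq_plane]
  nlinarith [sq_nonneg (p 0 - q 0)]

lemma dist_le_abs_add_abs (p q : Plane) : dist p q ≤ |p 0 - q 0| + |p 1 - q 1| := by
  refine le_of_sq_le_sq ?_ (by positivity)
  rw [dist_sq_plane, add_sq, sq_abs, sq_abs]
  nlinarith [mul_nonneg (abs_nonneg (p 0 - q 0)) (abs_nonneg (p 1 - q 1))]

lemma mul_dist_le_dist_diagMap {A B : ℝ} (u v : ℝ) (h : |B| ≤ |A|) (p q : Plane) :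
    |B| * dist p q ≤ dist (diagMap A B u v p) (diagMap A B u v q) := by
  refine le_of_sq_le_sq ?_ dist_nonneg
  rw [mul_pow, dist_sq_plane, dist_sq_plane]
  have := sq_le_sq.2 h
  simp only [diagMap_zero, diagMap_one, add_sub_add_right_eq_sub, ← mul_sub, mul_pow, sq_abs]
  nlinarith [sq_nonneg (p 0 - q 0)]

lemma dist_diagMap_le {A B : ℝ} (u v : ℝ) (h : |B| ≤ |A|) (p q : Plane) :
    dist (diagMap A B u v p) (diagMap A B u v q) ≤ |A| * dist p q := by
  refine le_of_sq_le_sq ?_ (by positivity)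
  rw [mul_pow, dist_sq_plane, dist_sq_plane]
  have := sq_le_sq.2 h
  simp only [diagMap_zero, diagMap_one, add_sub_add_right_eq_sub, ← mul_sub, mul_pow, sq_abs]
  nlinarith [sq_nonneg (p 1 - q 1)]

lemma diagMap_injective {A B : ℝ} (u v : ℝ) (hA : A ≠ 0) (hB : B ≠ 0) :
    Function.Injective (diagMap A B u v) := by
  intro p q h
  have h0 := congrArg (fun p : Plane => p 0) h
  have h1 := congrArg (fun p : Plane => p 1) h
  simp only [diagMap_zero, diagMap_one, add_left_inj, mul_eq_mul_left_iff, hA, hB, or_false]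
    at h0 h1
  exact Plane.ext h0 h1

/-- `F` is the attractor of the system of diagonal maps
`(x, y) ↦ (a i x + u i, b i y + v i)`, all of which contract, and contract at least as strongly in
the vertical as in the horizontal direction. -/
structure IsDiagonalAttractor {ι : Type*} (a b u v : ι → ℝ) (F : Set Plane) : Prop where
  pos : ∀ i, 0 < |b i|
  le : ∀ i, |b i| ≤ |a i|
  lt_one : ∀ i, |a i| < 1
  nonempty : F.Nonempty
  isCompact : IsCompact F
  eq : F = ⋃ i, diagMap (a i) (b i) (u i) (v i) '' F

section Attractor

variable {ι : Type*} {a b u v : ι → ℝ} {F : Set Plane}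

lemma IsDiagonalAttractor.mapsTo (h : IsDiagonalAttractor a b u v F) (i : ι) :
    MapsTo (diagMap (a i) (b i) (u i) (v i)) F F := fun p hp => by
  rw [h.eq]
  exact mem_iUnion.2 ⟨i, p, hp, rfl⟩

lemma IsDiagonalAttractor.index_nonempty (h : IsDiagonalAttractor a b u v F) : Nonempty ι := by
  obtain ⟨p, hp⟩ := h.nonempty
  rw [h.eq] at hp
  obtain ⟨i, -⟩ := mem_iUnion.1 hp
  exact ⟨i⟩

lemma IsDiagonalAttractor.image_eq (h : IsDiagonalAttractor a b u v F) (A B u' v' : ℝ) :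
    diagMap A B u' v' '' F = ⋃ i, diagMap (A * a i) (B * b i) (A * u i + u') (B * v i + v') '' F := by
  conv_lhs => rw [h.eq]
  simp only [image_iUnion, image_image, diagMap_comp]

/-- The horizontal projection of the attractor is self-similar, so it has a box-counting
dimension. -/
lemma IsDiagonalAttractor.exists_hasSepDim_proj [Finite ι] (h : IsDiagonalAttractor a b u v F) :
    ∃ s₁ : ℝ, 0 ≤ s₁ ∧ HasSepDim (π₁ '' F) s₁ := by
  have := h.index_nonempty
  have hcont : Continuous π₁ := by
    unfold π₁
    fun_prop
  have hb := (h.isCompact.image hcont).isBounded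
  obtain ⟨C, hC⟩ := card_le_of_separated_real hb
  refine exists_hasSepDim_of_selfSimilar (f := fun i x => a i * x + u i) (c := fun i => |a i|)
    (fun i => ⟨(h.pos i).trans_le (h.le i), h.lt_one i⟩) (fun i x y => ?_) ?_ hb
    (h.nonempty.image _) hC
  · rw [Real.dist_eq, Real.dist_eq, add_sub_add_right_eq_sub, ← mul_sub, abs_mul]
  · conv_lhs => rw [h.eq]
    simp only [image_iUnion, image_image]
    rfl

end Attractor

section Rpow

lemma rpow_neg_abs_le_rpow {x K t : ℝ} (hx : 1 ≤ x) (hxK : x ≤ K) : K ^ (-|t|) ≤ x ^ t :=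
  (Real.rpow_le_rpow_of_nonpos (by linarith) hxK (by simp)).trans
    (Real.rpow_le_rpow_of_exponent_le hx (neg_abs_le t))

lemma rpow_le_rpow_abs {x K t : ℝ} (hx : 1 ≤ x) (hxK : x ≤ K) : x ^ t ≤ K ^ |t| :=
  (Real.rpow_le_rpow_of_exponent_le hx (le_abs_self t)).trans
    (Real.rpow_le_rpow (by linarith) hxK (abs_nonneg t))

variable {X : Type*} [PseudoMetricSpace X] {A : Set X} {s : ℝ}

/-- The upper bound on separated sets holds at all bounded scales. -/
lemma HasSepDim.upper_of_le (h : HasSepDim A s) {ε K : ℝ} (hε : 0 < ε) (hK : 1 ≤ K) :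
    ∃ C > 0, ∀ δ, 0 < δ → δ ≤ K → ∀ Q : Finset X, ↑Q ⊆ A → Separated δ Q →
      (Q.card : ℝ) ≤ C * δ ^ (-(s + ε)) := by
  obtain ⟨C, hC, hU⟩ := h.upper ε hε
  have hK0 : 0 < K := by linarith
  have hK1 : K ^ (-|-(s + ε)|) ≤ 1 := Real.rpow_le_one_of_one_le_of_nonpos hK (by simp)
  refine ⟨C / K ^ (-|-(s + ε)|), by positivity, fun δ h0 h1 Q hQA hQ => ?_⟩
  rw [div_mul_eq_mul_div, le_div_iff₀ (by positivity)]
  rcases le_or_gt δ 1 with hδ | hδ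
  · calc (Q.card : ℝ) * K ^ (-|-(s + ε)|) ≤ Q.card * 1 := by gcongr
      _ ≤ C * δ ^ (-(s + ε)) := by rw [mul_one]; exact hU δ h0 hδ Q hQA hQ
  · have h2 := hU 1 one_pos le_rfl Q hQA (hQ.mono hδ.le subset_rfl)
    rw [Real.one_rpow, mul_one] at h2
    exact mul_le_mul h2 (rpow_neg_abs_le_rpow hδ.le h1) (by positivity) hC.le

/-- The lower bound on separated sets holds at all bounded scales. -/
lemma HasSepDim.lower_of_le (h : HasSepDim A s) (hA : A.Nonempty) {ε K : ℝ} (hε : 0 < ε)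
    (hK : 1 ≤ K) :
    ∃ c > 0, ∀ δ, 0 < δ → δ ≤ K → ∃ Q : Finset X, ↑Q ⊆ A ∧ Separated δ Q ∧
      c * δ ^ (-(s - ε)) ≤ (Q.card : ℝ) := by
  obtain ⟨c, hc, hL⟩ := h.lower ε hε
  have hK0 : 0 < K := by linarith
  refine ⟨min c (K ^ |-(s - ε)|)⁻¹, by positivity, fun δ h0 h1 => ?_⟩
  rcases le_or_gt δ 1 with hδ | hδ
  · obtain ⟨Q, hQA, hQ, h2⟩ := hL δ h0 hδ
    refine ⟨Q, hQA, hQ, le_trans ?_ h2⟩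
    gcongr
    exact min_le_left _ _
  · obtain ⟨x, hx⟩ := hA
    refine ⟨{x}, by simpa using hx, by simp [Separated], ?_⟩
    calc _ ≤ (K ^ |-(s - ε)|)⁻¹ * K ^ |-(s - ε)| := by
          gcongr
          · exact min_le_right _ _
          · exact rpow_le_rpow_abs hδ.le h1
      _ = _ := by
        rw [inv_mul_cancel₀ (by positivity)]
        simp

end Rpow

/-! ### Upper bound for the attractor -/

section Upper

variable {ι : Type*} [Fintype ι] {a b u v : ι → ℝ} {F : Set Plane}

lemma sum_rpow_mul (A B p q δ : ℝ) :
    ∑ i, |A * a i| ^ p * |B * b i| ^ q * δ =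
      |A| ^ p * |B| ^ q * δ * ∑ i, |a i| ^ p * |b i| ^ q := by
  rw [Finset.mul_sum]
  refine Finset.sum_congr rfl fun i _ => ?_
  rw [abs_mul, abs_mul, Real.mul_rpow (abs_nonneg _) (abs_nonneg _),
    Real.mul_rpow (abs_nonneg _) (abs_nonneg _)]
  ring

/-- Counting in an affine copy of `F`. A copy of height at most `δ` is counted by its
projection: there vertical distances are at most `D δ`, so points at distance more than `(1 + D) δ`
have projections at distance more than `δ`. A higher copy is split into the copies of the next
generation. -/
lemma IsDiagonalAttractor.card_le_image (h : IsDiagonalAttractor a b u v F) {p q C m M D δ : ℝ}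
    (hpq : ∑ i, |a i| ^ p * |b i| ^ q ≤ 1) (hC : 0 ≤ C) (hm : 0 < m)
    (hmb : ∀ i, m ≤ |b i|) (hMb : ∀ i, |b i| ≤ M) (hD : ∀ x ∈ F, ∀ y ∈ F, |x 1 - y 1| ≤ D)
    (hE : ∀ r, 0 < r → r ≤ m⁻¹ → ∀ Q : Finset ℝ, ↑Q ⊆ π₁ '' F → Separated r Q →
      (Q.card : ℝ) ≤ C * r ^ (-p)) (hδ : 0 < δ) (n : ℕ) :
    ∀ A B u' v' : ℝ, |B| ≤ |A| → m * δ ≤ |B| → |B| * M ^ n ≤ δ → ∀ Q : Finset Plane,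
      ↑Q ⊆ diagMap A B u' v' '' F → Separated ((1 + D) * δ) Q →
      (Q.card : ℝ) ≤ C * m ^ (-|q|) * (|A| ^ p * |B| ^ q * δ ^ (-(p + q))) := by
  have base : ∀ A B u' v' : ℝ, |B| ≤ |A| → m * δ ≤ |B| → |B| ≤ δ → ∀ Q : Finset Plane,
      ↑Q ⊆ diagMap A B u' v' '' F → Separated ((1 + D) * δ) Q →
      (Q.card : ℝ) ≤ C * m ^ (-|q|) * (|A| ^ p * |B| ^ q * δ ^ (-(p + q))) := by
    intro A B u' v' hBA hmB hBδ Q hQF hQ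
    have hB : 0 < |B| := lt_of_lt_of_le (by positivity) hmB
    have hA : 0 < |A| := hB.trans_le hBA
    have hpre : ∀ z : Plane, ∃ x : Plane, z ∈ Q → x ∈ F ∧ diagMap A B u' v' x = z := by
      intro z
      by_cases hz : z ∈ Q
      · obtain ⟨x, hx, hxz⟩ := hQF hz
        exact ⟨x, fun _ => ⟨hx, hxz⟩⟩
      · exact ⟨0, fun h => absurd h hz⟩
    choose g hg using hpre
    obtain ⟨P, hP1, hP2, hP3⟩ := exists_separated_image (r := δ / |A|) (by positivity)
      (S := Q) (f := fun z => π₁ (g z)) (by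
        intro z hz w hw hne
        have h1 : (1 + D) * δ < dist z w := hQ hz hw hne
        have h2 := dist_le_abs_add_abs z w
        obtain ⟨hzF, hz'⟩ := hg z hz
        obtain ⟨hwF, hw'⟩ := hg w hw
        have h3 : z 0 - w 0 = A * (π₁ (g z) - π₁ (g w)) := by
          conv_lhs => rw [← hz', ← hw']
          simp only [diagMap_zero, π₁]
          ring
        have h4 : z 1 - w 1 = B * (g z 1 - g w 1) := by
          conv_lhs => rw [← hz', ← hw']
          simp only [diagMap_one]
          ring
        rw [h3, h4, abs_mul, abs_mul] at h2
        have h5 : |B| * |g z 1 - g w 1| ≤ δ * D := by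
          gcongr
          exact hD _ hzF _ hwF
        rw [div_lt_iff₀ hA, Real.dist_eq, mul_comm]
        linarith)
    have h6 := hE (δ / |A|) (by positivity) (by
      rw [div_le_iff₀ hA, inv_mul_eq_div, le_div_iff₀ hm]
      linarith) P (by
        rw [hP1]
        rintro _ ⟨z, hz, rfl⟩
        exact ⟨g z, (hg z hz).1, rfl⟩) hP2
    rw [hP3] at h6
    refine h6.trans ?_
    have h7 : 1 ≤ m ^ (-|q|) * (|B| / δ) ^ q := by
      have h8 : (1 : ℝ) ≤ δ / |B| := by rwa [one_le_div hB]
      have h9 : δ / |B| ≤ m⁻¹ := by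
        rw [div_le_iff₀ hB, inv_mul_eq_div, le_div_iff₀ hm]
        linarith
      have h10 := rpow_neg_abs_le_rpow (t := -q) h8 h9
      rw [abs_neg, Real.inv_rpow hm.le, ← Real.rpow_neg hm.le, neg_neg, Real.rpow_neg (by positivity),
        ← Real.inv_rpow (by positivity), inv_div] at h10
      rw [Real.rpow_neg hm.le, inv_mul_eq_div, one_le_div (by positivity)]
      exact h10
    have h11 : |A| ^ p * |B| ^ q * δ ^ (-(p + q)) = (δ / |A|) ^ (-p) * (|B| / δ) ^ q := by
      rw [neg_add, Real.rpow_add hδ, Real.div_rpow hδ.le hA.le, Real.div_rpow hB.le hδ.le,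
        Real.rpow_neg hA.le, Real.rpow_neg hδ.le q]
      field_simp
    rw [h11]
    calc C * (δ / |A|) ^ (-p) ≤ C * (δ / |A|) ^ (-p) * (m ^ (-|q|) * (|B| / δ) ^ q) :=
          le_mul_of_one_le_right (by positivity) h7
      _ = _ := by ring
  induction n with
  | zero =>
    intro A B u' v' hBA hmB hBδ
    exact base A B u' v' hBA hmB (by simpa using hBδ)
  | succ n ih =>
    intro A B u' v' hBA hmB hBδ Q hQF hQ
    rcases le_or_gt |B| δ with hle | hlt
    · exact base A B u' v' hBA hmB hle Q hQF hQ
    classical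
    have hB : 0 < |B| := hδ.trans hlt
    let Q' : ι → Finset Plane := fun i =>
      {z ∈ Q | z ∈ diagMap (A * a i) (B * b i) (A * u i + u') (B * v i + v') '' F}
    have hcov : Q ⊆ Finset.univ.biUnion Q' := by
      intro z hz
      have := hQF hz
      rw [h.image_eq] at this
      obtain ⟨i, hi⟩ := mem_iUnion.1 this
      exact Finset.mem_biUnion.2 ⟨i, Finset.mem_univ i, Finset.mem_filter.2 ⟨hz, hi⟩⟩
    have h1 : (Q.card : ℝ) ≤ ∑ i, ((Q' i).card : ℝ) := by
      exact_mod_cast (Finset.card_le_card hcov).trans Finset.card_biUnion_le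
    calc (Q.card : ℝ) ≤ ∑ i, ((Q' i).card : ℝ) := h1
      _ ≤ ∑ i, C * m ^ (-|q|) * (|A * a i| ^ p * |B * b i| ^ q * δ ^ (-(p + q))) := by
        refine Finset.sum_le_sum fun i _ => ?_
        refine ih _ _ (A * u i + u') (B * v i + v') ?_ ?_ ?_ (Q' i) ?_ (hQ.mono le_rfl (Finset.filter_subset _ _))
        · rw [abs_mul, abs_mul]
          exact mul_le_mul hBA (h.le i) (abs_nonneg _) (abs_nonneg _)
        · rw [abs_mul, mul_comm]
          exact mul_le_mul hlt.le (hmb i) hm.le hB.le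
        · rw [abs_mul]
          calc |B| * |b i| * M ^ n ≤ |B| * M * M ^ n := by
                have : 0 ≤ M := (abs_nonneg _).trans (hMb i)
                gcongr
                exact hMb i
            _ = |B| * M ^ (n + 1) := by ring
            _ ≤ δ := hBδ
        · intro z hz
          exact (Finset.mem_filter.1 hz).2
      _ ≤ C * m ^ (-|q|) * (|A| ^ p * |B| ^ q * δ ^ (-(p + q))) := by
        rw [← Finset.mul_sum, sum_rpow_mul]
        exact mul_le_mul_of_nonneg_left (mul_le_of_le_one_right (by positivity) hpq)
          (by positivity)

lemma IsDiagonalAttractor.exists_bounds (h : IsDiagonalAttractor a b u v F) :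
    ∃ m M : ℝ, 0 < m ∧ m ≤ 1 ∧ M < 1 ∧ 0 ≤ M ∧ (∀ i, m ≤ |b i|) ∧ (∀ i, |a i| ≤ M) := by
  have := h.index_nonempty
  obtain ⟨i₀, hi₀⟩ := Finite.exists_min fun i => |b i|
  obtain ⟨i₁, hi₁⟩ := Finite.exists_max fun i => |a i|
  exact ⟨|b i₀|, |a i₁|, h.pos _, (h.le _).trans (h.lt_one _).le, h.lt_one _, abs_nonneg _, hi₀, hi₁⟩

/-- The upper half of `HasSepDim F s`. It needs no open set condition. -/
theorem IsDiagonalAttractor.upper (h : IsDiagonalAttractor a b u v F) {s₁ s : ℝ}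
    (hs₁ : HasSepDim (π₁ '' F) s₁) (hs : ∑ i, |a i| ^ s₁ * |b i| ^ (s - s₁) = 1) {ε : ℝ}
    (hε : 0 < ε) :
    ∃ C > 0, ∀ δ, 0 < δ → δ ≤ 1 → ∀ Q : Finset Plane, ↑Q ⊆ F → Separated δ Q →
      (Q.card : ℝ) ≤ C * δ ^ (-(s + ε)) := by
  obtain ⟨m, M, hm, hm1, hM1, hM0, hmb, hMa⟩ := h.exists_bounds
  obtain ⟨C, hC, hU⟩ := hs₁.upper_of_le hε (one_le_inv_iff₀.2 ⟨hm, hm1⟩)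
  obtain ⟨D, hD⟩ := Metric.isBounded_iff.1 h.isCompact.isBounded
  have hD0 : 0 ≤ max D 0 := le_max_right _ _
  refine ⟨C * m ^ (-|s - s₁|) * (1 + max D 0) ^ (s + ε), by positivity, fun δ h0 h1 Q hQF hQ => ?_⟩
  set D' := max D 0
  have hδ' : 0 < δ / (1 + D') := by positivity
  obtain ⟨n, hn⟩ := exists_pow_lt_of_lt_one hδ' hM1
  have hδ1 : δ / (1 + D') ≤ 1 := by
    rw [div_le_one (by positivity)]
    linarith
  have := h.card_le_image (p := s₁ + ε) (q := s - s₁) (C := C) (m := m) (M := M) (D := D')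
    (δ := δ / (1 + D')) (by
      rw [← hs]
      refine Finset.sum_le_sum fun i _ => ?_
      gcongr ?_ * _
      exact Real.rpow_le_rpow_of_exponent_ge ((h.pos i).trans_le (h.le i)) (h.lt_one i).le
        (by linarith)) hC.le hm hmb (fun i => (h.le i).trans (hMa i))
    (fun x hx y hy => (abs_sub_one_le_dist x y).trans ((hD hx hy).trans (le_max_left _ _))) hU
    hδ' n 1 1 0 0 le_rfl (by
      rw [abs_one]
      exact mul_le_one₀ hm1 hδ'.le hδ1) (by simpa using hn.le) Q
    (by simpa [funext diagMap_one_one] using hQF)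
    (by rwa [mul_div_cancel₀ _ (by positivity)])
  refine this.trans (le_of_eq ?_)
  rw [abs_one, Real.one_rpow, Real.one_rpow, Real.div_rpow h0.le (by positivity),
    show s₁ + ε + (s - s₁) = s + ε by ring, Real.rpow_neg (by positivity : 0 ≤ 1 + D')]
  field_simp

end Upper

/-! ### Lower bound for the attractor -/

section Lower

/-- An invariant compact set of a contracting system lies in every closed set which the system maps
into itself. -/
lemma subset_of_contracting {X ι : Type*} [PseudoMetricSpace X] {f : ι → X → X} {F T : Set X}
    {M : ℝ} (hM0 : 0 ≤ M) (hM : M < 1) (hf : ∀ i x y, dist (f i x) (f i y) ≤ M * dist x y)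
    (hF : IsCompact F) (hFf : F = ⋃ i, f i '' F) (hT : IsClosed T) (hTne : T.Nonempty)
    (hTf : ∀ i, MapsTo (f i) T T) : F ⊆ T := by
  intro x hx
  obtain ⟨z, hz, hmax⟩ := hF.exists_isMaxOn ⟨x, hx⟩ (Metric.continuous_infDist_pt T).continuousOn
  have hz' := hz
  rw [hFf] at hz'
  obtain ⟨i, w, hw, rfl⟩ := mem_iUnion.1 hz'
  have h1 : Metric.infDist (f i w) T ≤ M * Metric.infDist w T := by
    refine le_of_forall_pos_le_add fun ε hε => ?_
    obtain ⟨t, ht, hlt⟩ := (Metric.infDist_lt_iff hTne).1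
      (show Metric.infDist w T < Metric.infDist w T + ε by linarith)
    calc Metric.infDist (f i w) T ≤ dist (f i w) (f i t) :=
          Metric.infDist_le_dist_of_mem (hTf i ht)
      _ ≤ M * dist w t := hf i w t
      _ ≤ M * (Metric.infDist w T + ε) := by gcongr
      _ ≤ M * Metric.infDist w T + ε := by nlinarith
  have h2 : Metric.infDist w T ≤ Metric.infDist (f i w) T := hmax hw
  have h3 : Metric.infDist x T ≤ Metric.infDist (f i w) T := hmax hx
  have h4 : 0 ≤ Metric.infDist w T := Metric.infDist_nonneg
  have h5 : Metric.infDist (f i w) T ≤ 0 := by nlinarith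
  rw [hT.mem_iff_infDist_zero hTne]
  exact le_antisymm (h3.trans h5) Metric.infDist_nonneg

/-- A ball of radius `L δ` contains a bounded number of `ρ δ`-separated points, uniformly in
`δ`. -/
lemma exists_card_le_of_separated_ball {V : Type*} [NormedAddCommGroup V] [NormedSpace ℝ V]
    [ProperSpace V] (L : ℝ) {ρ : ℝ} (hρ : 0 < ρ) :
    ∃ N : ℕ, ∀ δ : ℝ, 0 < δ → ∀ (x : V) (Q : Finset V), ↑Q ⊆ Metric.closedBall x (L * δ) →
      Separated (ρ * δ) Q → Q.card ≤ N := by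
  obtain ⟨t, -, htf, ht⟩ := (isCompact_closedBall (0 : V) L).finite_cover_balls (half_pos hρ)
  refine ⟨htf.toFinset.card, fun δ hδ x Q hQx hQ => ?_⟩
  have hmem : ∀ q : Q, ∃ y ∈ t, δ⁻¹ • ((q : V) - x) ∈ Metric.ball y (ρ / 2) := by
    intro q
    have h1 : δ⁻¹ • ((q : V) - x) ∈ Metric.closedBall (0 : V) L := by
      have := hQx q.2
      rw [Metric.mem_closedBall, dist_eq_norm] at this
      rw [mem_closedBall_zero_iff, norm_smul, Real.norm_of_nonneg (by positivity),
        inv_mul_le_iff₀ hδ]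
      linarith
    simpa using ht h1
  choose f hft hf using hmem
  have hinj : Function.Injective fun q : Q => (⟨f q, htf.mem_toFinset.2 (hft q)⟩ : htf.toFinset) := by
    intro p q hpq
    by_contra hne
    have h1 : ρ * δ < dist (p : V) q := hQ p.2 q.2 fun h => hne (Subtype.ext h)
    have h2 : f p = f q := congrArg Subtype.val hpq
    have h3 := hf p
    have h4 := hf q
    rw [← h2] at h4
    rw [Metric.mem_ball] at h3 h4
    have h5 := dist_triangle_right (δ⁻¹ • ((p : V) - x)) (δ⁻¹ • ((q : V) - x)) (f p)
    rw [dist_smul₀, dist_sub_right, Real.norm_of_nonneg (by positivity)] at h5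
    have h6 : δ⁻¹ * dist (p : V) q < ρ := by linarith
    rw [inv_mul_lt_iff₀ hδ] at h6
    linarith
  simpa using Fintype.card_le_of_injective _ hinj

/-- A ball around an image point lies in the image of a rectangle as soon as the margins are large
enough in both directions. -/
lemma ball_subset_image_openRectangle {A B u v a₀ b₀ c₀ d₀ ρ : ℝ} {p : Plane} (hA : 0 < |A|)
    (hB : 0 < |B|) (h1 : ρ ≤ |A| * (p 0 - a₀)) (h2 : ρ ≤ |A| * (b₀ - p 0))
    (h3 : ρ ≤ |B| * (p 1 - c₀)) (h4 : ρ ≤ |B| * (d₀ - p 1)) :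
    Metric.ball (diagMap A B u v p) ρ ⊆ diagMap A B u v '' openRectangle a₀ b₀ c₀ d₀ := by
  intro z hz
  rw [Metric.mem_ball] at hz
  have hz0 := (abs_sub_zero_le_dist _ _).trans_lt hz
  have hz1 := (abs_sub_one_le_dist _ _).trans_lt hz
  have hA' : A ≠ 0 := abs_pos.1 hA
  have hB' : B ≠ 0 := abs_pos.1 hB
  refine ⟨!₂[(z 0 - u) / A, (z 1 - v) / B], ?_, ?_⟩
  · have e0 : z 0 - diagMap A B u v p 0 = A * ((z 0 - u) / A - p 0) := by
      rw [diagMap_zero]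
      field_simp
      ring
    have e1 : z 1 - diagMap A B u v p 1 = B * ((z 1 - v) / B - p 1) := by
      rw [diagMap_one]
      field_simp
      ring
    rw [e0, abs_mul] at hz0
    rw [e1, abs_mul] at hz1
    have k1 := abs_lt.1 (lt_of_mul_lt_mul_left (hz0.trans_le h1) hA.le)
    have k2 := abs_lt.1 (lt_of_mul_lt_mul_left (hz0.trans_le h2) hA.le)
    have k3 := abs_lt.1 (lt_of_mul_lt_mul_left (hz1.trans_le h3) hB.le)
    have k4 := abs_lt.1 (lt_of_mul_lt_mul_left (hz1.trans_le h4) hB.le)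
    refine ⟨⟨?_, ?_⟩, ⟨?_, ?_⟩⟩ <;> simp <;> linarith [k1.1, k2.2, k3.1, k4.2]
  · apply Plane.ext
    · simp
      field_simp
      ring
    · simp
      field_simp
      ring

variable {ι : Type*} [Fintype ι] {a b u v : ι → ℝ} {F : Set Plane}

/-- `Q` is a set of `r`-separated points within `K` of `diagMap A B u' v' '' F`, each the centre of a
ball of radius `2 r` inside the corresponding copy of the rectangle `R`. Such sets for different
copies with disjoint rectangles can be united. -/
structure IsInnerNet (F R : Set Plane) (r K A B u' v' : ℝ) (Q : Finset Plane) : Prop where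
  ball_subset : ∀ p ∈ Q, Metric.ball p (2 * r) ⊆ diagMap A B u' v' '' R
  near : ∀ p ∈ Q, ∃ f ∈ F, dist p (diagMap A B u' v' f) ≤ K
  separated : Separated r Q

/-- A copy of height about `δ` carries as many inner points as the projection of the attractor has
separated points at the corresponding scale. -/
lemma exists_isInnerNet_base {a₀ b₀ c₀ d₀ m H δ r₀ : ℝ} (hF0 : ∀ x ∈ F, x 0 ∈ Icc a₀ b₀)
    (hH : ∀ x ∈ F, |(c₀ + d₀) / 2 - x 1| ≤ H) (hm : 0 < m) (hm1 : m ≤ 1) (hδ : 0 < δ)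
    (hr0 : 0 < r₀) (hr1 : 4 * r₀ ≤ m * (b₀ - a₀)) (hr2 : 4 * r₀ ≤ m * (d₀ - c₀))
    (hr3 : 2 * r₀ ≤ 1) {A B u' v' : ℝ} (hBA : |B| ≤ |A|) (hmB : m * δ ≤ |B|) (hBδ : |B| ≤ δ)
    {P : Finset ℝ} (hPF : ↑P ⊆ π₁ '' F) (hP : Separated (δ / |A|) P) :
    ∃ Q : Finset Plane, Q.card = P.card ∧
      IsInnerNet F (openRectangle a₀ b₀ c₀ d₀) (r₀ / 2 * δ) ((b₀ - a₀ + H) * δ) A B u' v' Q := by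
  have hB : 0 < |B| := lt_of_lt_of_le (by positivity) hmB
  have hA : 0 < |A| := hB.trans_le hBA
  -- Points are pushed towards the vertical centre line by the ratio `lam`, so that they gain
  -- a margin proportional to `δ` from the vertical sides of the image rectangle.
  obtain ⟨lam, hlam⟩ : ∃ lam : ℝ, lam = m / 2 * (δ / |A|) := ⟨_, rfl⟩
  have hlam0 : 0 < lam := by rw [hlam]; positivity
  have hAlam : |A| * lam = m / 2 * δ := by rw [hlam]; field_simp
  have hlam1 : lam ≤ 1 / 2 := by
    have : lam * |A| ≤ 1 / 2 * |A| := by linarith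
    exact le_of_mul_le_mul_right this hA
  let x' : ℝ → Plane := fun x => !₂[(1 - lam) * x + lam * ((a₀ + b₀) / 2), (c₀ + d₀) / 2]
  have hx0 : ∀ x, x' x 0 = (1 - lam) * x + lam * ((a₀ + b₀) / 2) := fun x => rfl
  have hx1 : ∀ x, x' x 1 = (c₀ + d₀) / 2 := fun x => rfl
  obtain ⟨Q, hQ1, hQ2, hQ3⟩ := exists_separated_image (r := r₀ / 2 * δ) (by positivity)
    (S := P) (f := fun x => diagMap A B u' v' (x' x)) (by
      intro x hx y hy hne
      have h1 : δ / |A| < dist x y := hP hx hy hne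
      rw [div_lt_iff₀ hA, Real.dist_eq] at h1
      have h2 := abs_sub_zero_le_dist (diagMap A B u' v' (x' x)) (diagMap A B u' v' (x' y))
      have h3 : diagMap A B u' v' (x' x) 0 - diagMap A B u' v' (x' y) 0 =
          (1 - lam) * (A * (x - y)) := by
        simp only [diagMap_zero, hx0]
        ring
      rw [h3, abs_mul, abs_mul, abs_of_pos (by linarith : 0 < 1 - lam)] at h2
      refine lt_of_lt_of_le ?_ h2
      calc r₀ / 2 * δ < 1 / 2 * δ := by nlinarith
        _ ≤ (1 - lam) * (|A| * |x - y|) := by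
          refine mul_le_mul (by linarith) ?_ hδ.le (by linarith)
          rw [mul_comm]
          exact h1.le)
  refine ⟨Q, hQ3, ⟨?_, ?_, hQ2⟩⟩
  · intro p hp
    rw [← Finset.mem_coe, hQ1] at hp
    obtain ⟨x, hx, rfl⟩ := hp
    obtain ⟨f, hf, rfl⟩ := hPF hx
    obtain ⟨k1, k2⟩ := hF0 f hf
    have hab : a₀ ≤ b₀ := k1.trans k2
    have e : 2 * (r₀ / 2 * δ) ≤ |A| * (lam * ((b₀ - a₀) / 2)) := by
      rw [← mul_assoc |A|, hAlam]
      nlinarith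
    have e' : 2 * (r₀ / 2 * δ) ≤ |B| * ((d₀ - c₀) / 2) := by
      have : 0 ≤ d₀ - c₀ := by
        by_contra! hneg
        nlinarith
      calc 2 * (r₀ / 2 * δ) ≤ m * δ * ((d₀ - c₀) / 2) := by nlinarith
        _ ≤ _ := by gcongr
    refine ball_subset_image_openRectangle hA hB (e.trans ?_) (e.trans ?_) (e'.trans ?_)
      (e'.trans ?_)
    · gcongr
      rw [hx0]
      simp only [π₁]
      nlinarith
    · gcongr
      rw [hx0]
      simp only [π₁]
      nlinarith
    · gcongr
      rw [hx1]
      linarith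
    · gcongr
      rw [hx1]
      linarith
  · intro p hp
    rw [← Finset.mem_coe, hQ1] at hp
    obtain ⟨x, hx, rfl⟩ := hp
    obtain ⟨f, hf, rfl⟩ := hPF hx
    refine ⟨f, hf, (dist_le_abs_add_abs _ _).trans ?_⟩
    obtain ⟨k1, k2⟩ := hF0 f hf
    have e0 : diagMap A B u' v' (x' (π₁ f)) 0 - diagMap A B u' v' f 0 =
        A * (lam * ((a₀ + b₀) / 2 - f 0)) := by
      simp only [diagMap_zero, hx0, π₁]
      ring
    have e1 : diagMap A B u' v' (x' (π₁ f)) 1 - diagMap A B u' v' f 1 =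
        B * ((c₀ + d₀) / 2 - f 1) := by
      simp only [diagMap_one, hx1]
      ring
    rw [e0, e1, abs_mul, abs_mul, abs_mul, abs_of_pos hlam0, ← mul_assoc |A|, hAlam]
    have e2 : |(a₀ + b₀) / 2 - f 0| ≤ b₀ - a₀ := by
      rw [abs_le]
      constructor <;> linarith
    calc m / 2 * δ * |(a₀ + b₀) / 2 - f 0| + |B| * |(c₀ + d₀) / 2 - f 1|
        ≤ 1 * δ * (b₀ - a₀) + δ * H := by
          gcongr
          · linarith
          · exact hH f hf
      _ = (b₀ - a₀ + H) * δ := by ring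

/-- Inner nets of the copies of the next generation unite to an inner net, because the balls around
their points lie in disjoint rectangles. -/
lemma exists_isInnerNet_union {R : Set Plane} {r K : ℝ} (hr : 0 < r)
    (hR : ∀ i, diagMap (a i) (b i) (u i) (v i) '' R ⊆ R)
    (hdisj : Pairwise fun i j => Disjoint (diagMap (a i) (b i) (u i) (v i) '' R)
      (diagMap (a j) (b j) (u j) (v j) '' R))
    (hF : ∀ i, MapsTo (diagMap (a i) (b i) (u i) (v i)) F F)
    {A B u' v' : ℝ} (hA : A ≠ 0) (hB : B ≠ 0) {Q : ι → Finset Plane}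
    (hQ : ∀ i, IsInnerNet F R r K (A * a i) (B * b i) (A * u i + u') (B * v i + v') (Q i)) :
    ∃ Q' : Finset Plane, Q'.card = ∑ i, (Q i).card ∧ IsInnerNet F R r K A B u' v' Q' := by
  have himg : ∀ i, diagMap (A * a i) (B * b i) (A * u i + u') (B * v i + v') '' R =
      diagMap A B u' v' '' (diagMap (a i) (b i) (u i) (v i) '' R) := by
    intro i
    simp only [image_image, diagMap_comp]
  obtain ⟨Q', h1, h2, h3⟩ := exists_separated_image (r := r) hr.le
    (S := Finset.univ.sigma Q) (f := fun x => x.2) (by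
      rintro ⟨i, p⟩ hp ⟨j, q⟩ hq hne
      simp only [Finset.coe_sigma, Finset.coe_univ, mem_sigma_iff, mem_univ, true_and,
        Finset.mem_coe] at hp hq
      simp only
      by_cases hij : i = j
      · subst hij
        exact (hQ i).separated hp hq fun h => hne (by rw [h])
      · by_contra! hle
        have k1 := (hQ i).ball_subset p hp
          (show q ∈ Metric.ball p (2 * r) by rw [Metric.mem_ball, dist_comm]; linarith)
        have k2 := (hQ j).ball_subset q hq (Metric.mem_ball_self (by positivity))
        rw [himg] at k1 k2
        exact disjoint_left.1 ((disjoint_image_iff (diagMap_injective u' v' hA hB)).2 (hdisj hij))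
          k1 k2)
  have hmem : ∀ p ∈ Q', ∃ i, p ∈ Q i := by
    intro p hp
    rw [← Finset.mem_coe, h1] at hp
    obtain ⟨⟨i, q⟩, hq, rfl⟩ := hp
    simp only [Finset.coe_sigma, Finset.coe_univ, mem_sigma_iff, mem_univ, true_and,
        Finset.mem_coe] at hq
    exact ⟨i, hq⟩
  refine ⟨Q', by rw [h3, Finset.card_sigma], ⟨fun p hp => ?_, fun p hp => ?_, h2⟩⟩
  · obtain ⟨i, hi⟩ := hmem p hp
    refine ((hQ i).ball_subset p hi).trans ?_
    rw [himg]
    exact image_mono (hR i)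
  · obtain ⟨i, hi⟩ := hmem p hp
    obtain ⟨f, hf, hd⟩ := (hQ i).near p hi
    exact ⟨_, hF i hf, by rwa [diagMap_comp]⟩

/-- Inner nets of the size which the equation for `s` predicts, by induction over the number of
generations which are needed to reach height `δ`. -/
lemma IsDiagonalAttractor.exists_isInnerNet (h : IsDiagonalAttractor a b u v F)
    {a₀ b₀ c₀ d₀ m M H δ r₀ p q c : ℝ} (hF0 : ∀ x ∈ F, x 0 ∈ Icc a₀ b₀)
    (hH : ∀ x ∈ F, |(c₀ + d₀) / 2 - x 1| ≤ H) (hm : 0 < m) (hm1 : m ≤ 1) (hδ : 0 < δ)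
    (hr0 : 0 < r₀) (hr1 : 4 * r₀ ≤ m * (b₀ - a₀)) (hr2 : 4 * r₀ ≤ m * (d₀ - c₀))
    (hr3 : 2 * r₀ ≤ 1) (hmb : ∀ i, m ≤ |b i|) (hMb : ∀ i, |b i| ≤ M)
    (hR : ∀ i, diagMap (a i) (b i) (u i) (v i) '' openRectangle a₀ b₀ c₀ d₀ ⊆
      openRectangle a₀ b₀ c₀ d₀)
    (hdisj : Pairwise fun i j => Disjoint
      (diagMap (a i) (b i) (u i) (v i) '' openRectangle a₀ b₀ c₀ d₀)
      (diagMap (a j) (b j) (u j) (v j) '' openRectangle a₀ b₀ c₀ d₀))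
    (hpq : 1 ≤ ∑ i, |a i| ^ p * |b i| ^ q) (hc : 0 < c)
    (hE : ∀ r, 0 < r → r ≤ m⁻¹ → ∃ P : Finset ℝ, ↑P ⊆ π₁ '' F ∧ Separated r P ∧
      c * r ^ (-p) ≤ (P.card : ℝ)) (n : ℕ) :
    ∀ A B u' v' : ℝ, |B| ≤ |A| → m * δ ≤ |B| → |B| * M ^ n ≤ δ → ∃ Q : Finset Plane,
      c * m ^ |q| * (|A| ^ p * |B| ^ q * δ ^ (-(p + q))) ≤ (Q.card : ℝ) ∧
      IsInnerNet F (openRectangle a₀ b₀ c₀ d₀) (r₀ / 2 * δ) ((b₀ - a₀ + H) * δ) A B u' v' Q := by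
  have base : ∀ A B u' v' : ℝ, |B| ≤ |A| → m * δ ≤ |B| → |B| ≤ δ → ∃ Q : Finset Plane,
      c * m ^ |q| * (|A| ^ p * |B| ^ q * δ ^ (-(p + q))) ≤ (Q.card : ℝ) ∧
      IsInnerNet F (openRectangle a₀ b₀ c₀ d₀) (r₀ / 2 * δ) ((b₀ - a₀ + H) * δ) A B u' v' Q := by
    intro A B u' v' hBA hmB hBδ
    have hB : 0 < |B| := lt_of_lt_of_le (by positivity) hmB
    have hA : 0 < |A| := hB.trans_le hBA
    obtain ⟨P, hPF, hP, hcard⟩ := hE (δ / |A|) (by positivity) (by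
      rw [div_le_iff₀ hA, inv_mul_eq_div, le_div_iff₀ hm]
      linarith)
    obtain ⟨Q, hQ1, hQ2⟩ := exists_isInnerNet_base hF0 hH hm hm1 hδ hr0 hr1 hr2 hr3 hBA hmB hBδ
      (u' := u') (v' := v') hPF hP
    refine ⟨Q, ?_, hQ2⟩
    rw [hQ1]
    refine le_trans ?_ hcard
    have h7 : m ^ |q| * (|B| / δ) ^ q ≤ 1 := by
      have h8 : (1 : ℝ) ≤ δ / |B| := by rwa [one_le_div hB]
      have h9 : δ / |B| ≤ m⁻¹ := by
        rw [div_le_iff₀ hB, inv_mul_eq_div, le_div_iff₀ hm]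
        linarith
      have h10 := rpow_le_rpow_abs (t := -q) h8 h9
      rw [abs_neg, Real.inv_rpow hm.le, Real.rpow_neg (by positivity),
        ← Real.inv_rpow (by positivity), inv_div] at h10
      calc m ^ |q| * (|B| / δ) ^ q ≤ m ^ |q| * (m ^ |q|)⁻¹ := by gcongr
        _ = 1 := mul_inv_cancel₀ (by positivity)
    have h11 : |A| ^ p * |B| ^ q * δ ^ (-(p + q)) = (δ / |A|) ^ (-p) * (|B| / δ) ^ q := by
      rw [neg_add, Real.rpow_add hδ, Real.div_rpow hδ.le hA.le, Real.div_rpow hB.le hδ.le,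
        Real.rpow_neg hA.le, Real.rpow_neg hδ.le q]
      field_simp
    rw [h11]
    calc c * m ^ |q| * ((δ / |A|) ^ (-p) * (|B| / δ) ^ q)
        = c * (δ / |A|) ^ (-p) * (m ^ |q| * (|B| / δ) ^ q) := by ring
      _ ≤ c * (δ / |A|) ^ (-p) := mul_le_of_le_one_right (by positivity) h7
  induction n with
  | zero =>
    intro A B u' v' hBA hmB hBδ
    exact base A B u' v' hBA hmB (by simpa using hBδ)
  | succ n ih =>
    intro A B u' v' hBA hmB hBδ
    rcases le_or_gt |B| δ with hle | hlt
    · exact base A B u' v' hBA hmB hle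
    have hB : 0 < |B| := hδ.trans hlt
    have hnext : ∀ i, ∃ Q : Finset Plane,
        c * m ^ |q| * (|A * a i| ^ p * |B * b i| ^ q * δ ^ (-(p + q))) ≤ (Q.card : ℝ) ∧
        IsInnerNet F (openRectangle a₀ b₀ c₀ d₀) (r₀ / 2 * δ) ((b₀ - a₀ + H) * δ)
          (A * a i) (B * b i) (A * u i + u') (B * v i + v') Q := by
      intro i
      refine ih _ _ (A * u i + u') (B * v i + v') ?_ ?_ ?_
      · rw [abs_mul, abs_mul]
        exact mul_le_mul hBA (h.le i) (abs_nonneg _) (abs_nonneg _)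
      · rw [abs_mul, mul_comm]
        exact mul_le_mul hlt.le (hmb i) hm.le hB.le
      · rw [abs_mul]
        calc |B| * |b i| * M ^ n ≤ |B| * M * M ^ n := by
              have : 0 ≤ M := (abs_nonneg _).trans (hMb i)
              gcongr
              exact hMb i
          _ = |B| * M ^ (n + 1) := by ring
          _ ≤ δ := hBδ
    choose Q hQ1 hQ2 using hnext
    obtain ⟨Q', h1, h2⟩ := exists_isInnerNet_union (by positivity) hR hdisj h.mapsTo
      (abs_pos.1 (hB.trans_le hBA)) (abs_pos.1 hB) hQ2
    refine ⟨Q', ?_, h2⟩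
    rw [h1]
    rw [Nat.cast_sum]
    calc c * m ^ |q| * (|A| ^ p * |B| ^ q * δ ^ (-(p + q)))
        ≤ ∑ i, c * m ^ |q| * (|A * a i| ^ p * |B * b i| ^ q * δ ^ (-(p + q))) := by
          rw [← Finset.mul_sum, sum_rpow_mul]
          exact mul_le_mul_of_nonneg_left (le_mul_of_one_le_right (by positivity) hpq)
            (by positivity)
      _ ≤ ∑ i, ((Q i).card : ℝ) := Finset.sum_le_sum fun i _ => hQ1 i

/-- The box-counting dimension of the attractor is the solution `s` of the Moran-type equation. -/
theorem IsDiagonalAttractor.hasSepDim (h : IsDiagonalAttractor a b u v F) {a₀ b₀ c₀ d₀ : ℝ}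
    (hRne : (openRectangle a₀ b₀ c₀ d₀).Nonempty)
    (hR : ∀ i, diagMap (a i) (b i) (u i) (v i) '' openRectangle a₀ b₀ c₀ d₀ ⊆
      openRectangle a₀ b₀ c₀ d₀)
    (hdisj : Pairwise fun i j => Disjoint
      (diagMap (a i) (b i) (u i) (v i) '' openRectangle a₀ b₀ c₀ d₀)
      (diagMap (a j) (b j) (u j) (v j) '' openRectangle a₀ b₀ c₀ d₀)) {s₁ s : ℝ}
    (hs₁ : HasSepDim (π₁ '' F) s₁) (hs : ∑ i, |a i| ^ s₁ * |b i| ^ (s - s₁) = 1) :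
    HasSepDim F s := by
  refine ⟨fun ε hε => h.upper hs₁ hs hε, fun ε hε => ?_⟩
  obtain ⟨m, M, hm, hm1, hM1, hM0, hmb, hMa⟩ := h.exists_bounds
  obtain ⟨c, hc, hL⟩ := hs₁.lower_of_le (h.nonempty.image _) hε (one_le_inv_iff₀.2 ⟨hm, hm1⟩)
  obtain ⟨p₀, hp₀⟩ := hRne
  have hab : a₀ < b₀ := hp₀.1.1.trans hp₀.1.2
  have hcd : c₀ < d₀ := hp₀.2.1.trans hp₀.2.2
  have hmaps : ∀ i, MapsTo (diagMap (a i) (b i) (u i) (v i)) (openRectangle a₀ b₀ c₀ d₀)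
      (openRectangle a₀ b₀ c₀ d₀) := fun i => mapsTo_iff_image_subset.2 (hR i)
  have hcl : F ⊆ closure (openRectangle a₀ b₀ c₀ d₀) := by
    refine subset_of_contracting (f := fun i => diagMap (a i) (b i) (u i) (v i)) hM0 hM1
      (fun i x y => (dist_diagMap_le _ _ (h.le i) x y).trans (by gcongr; exact hMa i))
      h.isCompact h.eq isClosed_closure ⟨p₀, subset_closure hp₀⟩ fun i => (hmaps i).closure ?_
    unfold diagMap
    fun_prop
  have hF0 : ∀ x ∈ F, x 0 ∈ Icc a₀ b₀ := by
    have hclosed : IsClosed {p : Plane | p 0 ∈ Icc a₀ b₀} :=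
      isClosed_Icc.preimage (by fun_prop : Continuous fun p : Plane => p 0)
    intro x hx
    have hsub : openRectangle a₀ b₀ c₀ d₀ ⊆ {p : Plane | p 0 ∈ Icc a₀ b₀} :=
      fun p hp => Ioo_subset_Icc_self hp.1
    exact closure_minimal hsub hclosed (hcl hx)
  obtain ⟨H, hH0, hH⟩ : ∃ H : ℝ, 0 ≤ H ∧ ∀ x ∈ F, |(c₀ + d₀) / 2 - x 1| ≤ H := by
    obtain ⟨D, hD⟩ := h.isCompact.isBounded.subset_closedBall p₀
    refine ⟨|D| + |(c₀ + d₀) / 2 - p₀ 1|, by positivity, fun x hx => ?_⟩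
    have h1 := (abs_sub_one_le_dist p₀ x)
    have h2 := hD hx
    rw [Metric.mem_closedBall, dist_comm] at h2
    have h3 := abs_sub_le ((c₀ + d₀) / 2) (p₀ 1) (x 1)
    linarith [le_abs_self D]
  obtain ⟨r₀, hr0, hr1, hr2, hr3⟩ : ∃ r₀ : ℝ, 0 < r₀ ∧ 4 * r₀ ≤ m * (b₀ - a₀) ∧
      4 * r₀ ≤ m * (d₀ - c₀) ∧ 2 * r₀ ≤ 1 := by
    have h1 : 0 < m * (b₀ - a₀) := mul_pos hm (by linarith)
    have h2 : 0 < m * (d₀ - c₀) := mul_pos hm (by linarith)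
    refine ⟨min (min (m * (b₀ - a₀)) (m * (d₀ - c₀))) 1 / 4, by positivity, ?_, ?_, ?_⟩
    · linarith [min_le_left (min (m * (b₀ - a₀)) (m * (d₀ - c₀))) 1,
        min_le_left (m * (b₀ - a₀)) (m * (d₀ - c₀))]
    · linarith [min_le_left (min (m * (b₀ - a₀)) (m * (d₀ - c₀))) 1,
        min_le_right (m * (b₀ - a₀)) (m * (d₀ - c₀))]
    · linarith [min_le_right (min (m * (b₀ - a₀)) (m * (d₀ - c₀))) 1]
  set K := b₀ - a₀ + H with hK
  -- The points of an inner net need not lie in `F`, so they are assigned to the points of a maximal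
  -- separated subset of `F`, at most `N` of them to each.
  obtain ⟨N, hN⟩ := exists_card_le_of_separated_ball (V := Plane) (K + 1) (half_pos hr0)
  refine ⟨c * m ^ |s - s₁| / (N + 1), by positivity, fun δ h0 h1 => ?_⟩
  obtain ⟨C, hC, hU⟩ := h.upper hs₁ hs hε
  obtain ⟨Z, hZF, hZ, hnet⟩ := exists_maximal_separated h0.le (hU δ h0 h1)
  refine ⟨Z, hZF, hZ, ?_⟩
  obtain ⟨n, hn⟩ := exists_pow_lt_of_lt_one h0 hM1
  obtain ⟨Q, hQcard, hQ⟩ := h.exists_isInnerNet (p := s₁ - ε) (q := s - s₁) hF0 hH hm hm1 h0 hr0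
    hr1 hr2 hr3 hmb (fun i => (h.le i).trans (hMa i)) hR hdisj (by
      rw [← hs]
      refine Finset.sum_le_sum fun i _ => ?_
      gcongr ?_ * _
      exact Real.rpow_le_rpow_of_exponent_ge ((h.pos i).trans_le (h.le i)) (h.lt_one i).le
        (by linarith)) hc hL n 1 1 0 0 le_rfl (by
      rw [abs_one]
      exact mul_le_one₀ hm1 h0.le h1) (by simpa using hn.le)
  have hnear : ∀ z : Plane, ∃ w : Plane, z ∈ Q → w ∈ Z ∧ dist z w ≤ (K + 1) * δ := by
    intro z
    by_cases hz : z ∈ Q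
    · obtain ⟨f, hf, hd⟩ := hQ.near z hz
      rw [diagMap_one_one] at hd
      obtain ⟨w, hw, hd'⟩ := hnet f hf
      refine ⟨w, fun _ => ⟨hw, (dist_triangle z f w).trans ?_⟩⟩
      linarith
    · exact ⟨0, fun h => absurd h hz⟩
  choose g hg using hnear
  have hQZ : Q.card ≤ N * Z.card := by
    classical
    refine Finset.card_le_mul_card_image_of_maps_to (f := g) (fun z hz => (hg z hz).1) N
      fun w _ => ?_
    refine hN δ h0 w _ ?_ (hQ.separated.mono le_rfl (Finset.filter_subset _ _))
    intro z hz
    obtain ⟨hz1, rfl⟩ := Finset.mem_filter.1 hz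
    exact (hg z hz1).2
  have hQZ' : (Q.card : ℝ) ≤ N * Z.card := by exact_mod_cast hQZ
  rw [abs_one, Real.one_rpow, Real.one_rpow, show s₁ - ε + (s - s₁) = s - ε by ring] at hQcard
  rw [div_mul_eq_mul_div, div_le_iff₀ (by positivity)]
  nlinarith [Nat.cast_nonneg (α := ℝ) Z.card]

end Lower

/-! ### Packing dimension -/

section Packing

/-- In a packing, the balls of radius about `2 ^ (-k)` have separated centres, so their total
contribution is geometrically small in `k`. -/
theorem HasSepDim.packingMeasure_ne_top {X : Type*} [PseudoMetricSpace X] {A : Set X} {s t : ℝ}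
    (h : HasSepDim A s) (hst : s < t) (ht : 0 ≤ t) : packingMeasure t A ≠ ∞ := by
  set ε := (t - s) / 2 with hε
  have hε0 : 0 < ε := by linarith
  obtain ⟨C, hC, hU⟩ := h.upper ε hε0
  set θ : ℝ := (1 / 2) ^ ε with hθ
  have hθ0 : 0 < θ := by positivity
  have hθ1 : θ < 1 := Real.rpow_lt_one (by norm_num) (by norm_num) hε0
  set C' : ℝ := C * (1 / 2) ^ (-(s + ε)) * 2 ^ t with hC'
  have hC'0 : 0 < C' := by positivity
  have key : packingSup t 1 A ≤ ENNReal.ofReal (C' * (1 - θ)⁻¹) := by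
    refine iSup₂_le fun P ⟨_, hP, hdisj⟩ => ?_
    rw [ENNReal.tsum_eq_iSup_sum]
    refine iSup_le fun T => ?_
    have hr : ∀ p : P, ∃ k : ℕ, (1 / 2 : ℝ) ^ (k + 1) < p.1.2 ∧ p.1.2 ≤ (1 / 2) ^ k :=
      fun p => exists_nat_pow_near_of_lt_one (hP p p.2).2.1 (hP p p.2).2.2 (by norm_num)
        (by norm_num)
    choose k hk1 hk2 using hr
    rw [← ENNReal.ofReal_sum_of_nonneg fun p _ => by
      have := (hP p p.2).2.1
      positivity]
    refine ENNReal.ofReal_le_ofReal ?_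
    rw [← Finset.sum_fiberwise_of_maps_to (t := T.image k) fun p hp => Finset.mem_image_of_mem k hp]
    calc ∑ j ∈ T.image k, ∑ p ∈ T with k p = j, (2 * p.1.2) ^ t
        ≤ ∑ j ∈ T.image k, C' * θ ^ j := by
          refine Finset.sum_le_sum fun j _ => ?_
          have hle : ∀ p ∈ T.filter (fun p => k p = j), (2 * p.1.2) ^ t ≤ 2 ^ t * ((1 / 2) ^ j) ^ t := by
            intro p hp
            have hp0 := (hP p p.2).2.1
            rw [Real.mul_rpow zero_le_two hp0.le]
            have := hk2 p
            rw [(Finset.mem_filter.1 hp).2] at this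
            gcongr
          refine (Finset.sum_le_card_nsmul _ _ _ hle).trans ?_
          obtain ⟨Q, hQ1, hQ2, hQ3⟩ := exists_separated_image (r := (1 / 2 : ℝ) ^ (j + 1))
            (by positivity) (S := T.filter (fun p => k p = j)) (f := fun p => p.1.1) (by
              intro p hp q hq hne
              have h1 := hdisj p.2 q.2 fun h => hne (Subtype.ext h)
              have h2 : q.1.1 ∉ Metric.closedBall p.1.1 p.1.2 :=
                fun h => disjoint_left.1 h1 h (Metric.mem_closedBall_self (hP q q.2).2.1.le)
              rw [Metric.mem_closedBall, not_le, dist_comm] at h2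
              have h3 := hk1 p
              rw [(Finset.mem_filter.1 hp).2] at h3
              exact h3.trans h2)
          have h4 := hU _ (by positivity) (pow_le_one₀ (by norm_num) (by norm_num)) Q (by
            rw [hQ1]
            rintro _ ⟨p, -, rfl⟩
            exact (hP p p.2).1) hQ2
          rw [hQ3] at h4
          rw [nsmul_eq_mul]
          refine (mul_le_mul_of_nonneg_right h4 (by positivity)).trans (le_of_eq ?_)
          have h5 : ((1 / 2 : ℝ) ^ j) ^ (-(s + ε)) * ((1 / 2 : ℝ) ^ j) ^ t = θ ^ j := by
            rw [← Real.rpow_add (by positivity), hθ, ← Real.rpow_natCast, ← Real.rpow_natCast,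
              ← Real.rpow_mul (by norm_num), ← Real.rpow_mul (by norm_num)]
            congr 1
            rw [hε]
            ring
          rw [pow_succ, Real.mul_rpow (by positivity) (by norm_num), hC', ← h5]
          ring
      _ = C' * ∑ j ∈ T.image k, θ ^ j := by rw [Finset.mul_sum]
      _ ≤ C' * (1 - θ)⁻¹ := by
        gcongr
        rw [← tsum_geometric_of_lt_one hθ0.le hθ1]
        exact (summable_geometric_of_lt_one hθ0.le hθ1).sum_le_tsum _ fun _ _ => by positivity
  have hempty : packingPremeasure t (∅ : Set X) = 0 := by
    refine le_antisymm (iInf₂_le_of_le 1 one_pos (iSup₂_le fun P hP => ?_)) zero_le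
    have : IsEmpty P := ⟨fun p => (hP.2.1 p p.2).1⟩
    simp
  refine ne_top_of_le_ne_top (b := ENNReal.ofReal (C' * (1 - θ)⁻¹)) ENNReal.ofReal_ne_top ?_
  refine iInf₂_le_of_le (fun n => if n = 0 then A else ∅) (fun x hx => mem_iUnion.2 ⟨0, by simpa⟩) ?_
  rw [tsum_eq_single 0 fun n hn => by simp [hn, hempty]]
  simp only [if_true]
  exact (iInf₂_le 1 one_pos).trans key

/-- A similarity-like map `g` which expands distances at least by `β` transports separated subsets
of `F` to packings of any set `B` whose closure contains `g '' F`. -/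
lemma HasSepDim.packingPremeasure_eq_top {X Y : Type*} [PseudoMetricSpace X] [PseudoMetricSpace Y]
    {F : Set X} {s t : ℝ} (h : HasSepDim F s) (hts : t < s) {g : X → Y} {β : ℝ} (hβ : 0 < β)
    (hg : ∀ x y, β * dist x y ≤ dist (g x) (g y)) {B : Set Y} (hB : ∀ x ∈ F, g x ∈ closure B) :
    packingPremeasure t B = ∞ := by
  classical
  set ε := (s - t) / 2 with hε
  have hε0 : 0 < ε := by linarith
  obtain ⟨c, hc, hL⟩ := h.lower ε hε0
  refine iInf₂_eq_top.2 fun δ hδ => ?_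
  refine ENNReal.eq_top_of_forall_nnreal_le fun K => ?_
  have hlim : Tendsto (fun η : ℝ => c * (2 * β / 5) ^ t * (η⁻¹) ^ ε) (𝓝[>] 0) atTop :=
    ((tendsto_rpow_atTop hε0).comp tendsto_inv_nhdsGT_zero).const_mul_atTop (by positivity)
  obtain ⟨η, hηK, ⟨hη0, hη1⟩, hηδ⟩ := ((hlim.eventually_ge_atTop (K : ℝ)).and
    (inter_mem (Ioc_mem_nhdsGT (zero_lt_one' ℝ)) (Ioc_mem_nhdsGT (div_pos hδ hβ)))).exists
  have hηδ' : β * η / 5 ≤ δ := by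
    have := hηδ.2
    rw [le_div_iff₀ hβ] at this
    nlinarith
  obtain ⟨Q, hQF, hQ, hcard⟩ := hL η hη0 hη1
  have hnear : ∀ q : X, ∃ b : Y, q ∈ Q → b ∈ B ∧ dist (g q) b < β * η / 4 := by
    intro q
    by_cases hq : q ∈ Q
    · obtain ⟨b, hb, hd⟩ := Metric.mem_closure_iff.1 (hB q (hQF hq)) (β * η / 4) (by positivity)
      exact ⟨b, fun _ => ⟨hb, hd⟩⟩
    · exact ⟨g q, fun h => absurd h hq⟩
  -- The points `b q` are `β η / 2` apart, which leaves room for disjoint balls of radius `β η / 5`.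
  choose b hb using hnear
  have hsep : ∀ p ∈ Q, ∀ q ∈ Q, p ≠ q → β * η / 2 < dist (b p) (b q) := by
    intro p hp q hq hne
    have h1 : η < dist p q := hQ hp hq hne
    have h2 := hg p q
    have h3 := (hb p hp).2
    have h4 := (hb q hq).2
    have h5 := dist_triangle4 (g p) (b p) (b q) (g q)
    rw [dist_comm (b q)] at h5
    nlinarith
  have hinj : (Q : Set X).InjOn fun q => (b q, β * η / 5) := by
    intro p hp q hq hpq
    by_contra hne
    have h1 := hsep p hp q hq hne
    rw [show b p = b q from (Prod.ext_iff.1 hpq).1, dist_self] at h1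
    have : 0 < β * η / 2 := by positivity
    linarith
  refine le_trans ?_ (le_iSup₂ (f := fun (P : Set (Y × ℝ)) (_ : IsBallPacking δ B P) =>
    ∑' p : P, ENNReal.ofReal ((2 * p.1.2) ^ t)) (↑(Q.image fun q => (b q, β * η / 5)))
    ⟨Finset.countable_toSet _, ?_, ?_⟩)
  · rw [Finset.tsum_subtype' (Q.image fun q => (b q, β * η / 5))
      (fun p : Y × ℝ => ENNReal.ofReal ((2 * p.2) ^ t)), Finset.sum_image hinj]
    simp only
    rw [Finset.sum_const, nsmul_eq_mul, ← ENNReal.ofReal_natCast, ← ENNReal.ofReal_mul (Nat.cast_nonneg _),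
      ← ENNReal.ofReal_coe_nnreal]
    refine ENNReal.ofReal_le_ofReal (hηK.trans ?_)
    calc c * (2 * β / 5) ^ t * η⁻¹ ^ ε = c * η ^ (-(s - ε)) * (2 * (β * η / 5)) ^ t := by
          rw [show 2 * (β * η / 5) = 2 * β / 5 * η by ring, Real.mul_rpow (by positivity) hη0.le,
            Real.inv_rpow hη0.le, ← Real.rpow_neg hη0.le]
          have : η ^ (-ε) = η ^ (-(s - ε)) * η ^ t := by
            rw [← Real.rpow_add hη0]
            congr 1
            rw [hε]
            ring
          rw [this]
          ring
      _ ≤ Q.card * (2 * (β * η / 5)) ^ t := by gcongr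
  · intro p hp
    simp only [Finset.coe_image, mem_image, Finset.mem_coe] at hp
    obtain ⟨q, hq, rfl⟩ := hp
    exact ⟨(hb q hq).1, by positivity, hηδ'⟩
  · intro p hp q hq hne
    simp only [Finset.coe_image, mem_image, Finset.mem_coe] at hp hq
    obtain ⟨p, hp, rfl⟩ := hp
    obtain ⟨q, hq, rfl⟩ := hq
    refine Metric.closedBall_disjoint_closedBall ?_
    have h1 := hsep p hp q hq fun h => hne (by rw [h])
    have : 0 < β * η := by positivity
    simp only
    linarith

variable {ι : Type*} {a b u v : ι → ℝ} {F : Set Plane}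

/-- Every point of the attractor lies in arbitrarily small affine copies of it. -/
lemma IsDiagonalAttractor.exists_copy (h : IsDiagonalAttractor a b u v F) {M : ℝ}
    (hM : ∀ i, |a i| ≤ M) (n : ℕ) : ∀ x ∈ F, ∃ A B u' v' : ℝ, 0 < |B| ∧ |B| ≤ |A| ∧ |A| ≤ M ^ n ∧
      MapsTo (diagMap A B u' v') F F ∧ x ∈ diagMap A B u' v' '' F := by
  induction n with
  | zero =>
    intro x hx
    refine ⟨1, 1, 0, 0, by simp, le_rfl, by simp, fun p hp => ?_, x, hx, diagMap_one_one x⟩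
    rwa [diagMap_one_one]
  | succ n ih =>
    intro x hx
    rw [h.eq] at hx
    obtain ⟨i, y, hy, rfl⟩ := mem_iUnion.1 hx
    obtain ⟨A, B, u', v', h1, h2, h3, h4, z, hz, rfl⟩ := ih y hy
    refine ⟨a i * A, b i * B, a i * u' + u i, b i * v' + v i, ?_, ?_, ?_, ?_, z, hz, ?_⟩
    · rw [abs_mul]
      exact mul_pos (h.pos i) h1
    · rw [abs_mul, abs_mul]
      exact mul_le_mul (h.le i) h2 (abs_nonneg _) (abs_nonneg _)
    · rw [abs_mul, pow_succ']
      exact mul_le_mul (hM i) h3 (abs_nonneg _) ((abs_nonneg _).trans (hM i))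
    · intro p hp
      rw [← diagMap_comp]
      exact h.mapsTo i (h4 hp)
    · rw [diagMap_comp]

/-- Baire's theorem: one piece of any countable cover of a compact set is dense in a relatively
open part of it. -/
lemma exists_subset_closure_of_cover {X : Type*} [MetricSpace X] {F : Set X} (hF : IsCompact F)
    (hne : F.Nonempty) {B : ℕ → Set X} (hB : F ⊆ ⋃ n, B n) :
    ∃ n, ∃ x ∈ F, ∃ ρ > 0, ∀ y ∈ F, dist y x < ρ → y ∈ closure (B n) := by
  have : Nonempty F := hne.to_subtype
  have : CompactSpace F := isCompact_iff_compactSpace.1 hF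
  obtain ⟨n, x, hx⟩ := nonempty_interior_of_iUnion_of_closed
    (f := fun n => ((↑) : F → X) ⁻¹' closure (B n))
    (fun n => isClosed_closure.preimage continuous_subtype_val) (by
      rw [← preimage_iUnion, eq_univ_iff_forall]
      intro x
      obtain ⟨n, hn⟩ := mem_iUnion.1 (hB x.2)
      exact mem_iUnion.2 ⟨n, subset_closure hn⟩)
  obtain ⟨ρ, hρ, hball⟩ := Metric.mem_nhds_iff.1 (mem_interior_iff_mem_nhds.1 hx)
  exact ⟨n, x, x.2, ρ, hρ, fun y hy hyx =>
    hball (show (⟨y, hy⟩ : F) ∈ Metric.ball x ρ from hyx)⟩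

/-- One piece of any countable cover of the attractor is dense in an affine copy of it, and such a
piece has infinite packing premeasure. -/
theorem IsDiagonalAttractor.packingMeasure_eq_top [Finite ι] (h : IsDiagonalAttractor a b u v F)
    {s t : ℝ} (hs : HasSepDim F s) (hts : t < s) : packingMeasure t F = ∞ := by
  cases nonempty_fintype ι
  refine iInf₂_eq_top.2 fun B hB => ?_
  obtain ⟨n, x, hx, ρ, hρ, hball⟩ := exists_subset_closure_of_cover h.isCompact h.nonempty hB
  obtain ⟨m, M, -, -, hM1, hM0, -, hMa⟩ := h.exists_bounds
  obtain ⟨D, hD⟩ := Metric.isBounded_iff.1 h.isCompact.isBounded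
  obtain ⟨k, hk⟩ := exists_pow_lt_of_lt_one (div_pos hρ (by positivity : 0 < |D| + 1)) hM1
  rw [lt_div_iff₀ (by positivity)] at hk
  obtain ⟨A, B', u', v', hB', hBA, hA, hmaps, z, hz, hzx⟩ := h.exists_copy hMa k x hx
  refine ENNReal.tsum_eq_top_of_eq_top ⟨n, ?_⟩
  refine hs.packingPremeasure_eq_top hts hB' (mul_dist_le_dist_diagMap u' v' hBA) fun y hy => ?_
  refine hball _ (hmaps hy) ?_
  calc dist (diagMap A B' u' v' y) x ≤ |A| * dist y z := by
        rw [← hzx]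
        exact dist_diagMap_le _ _ hBA _ _
    _ ≤ M ^ k * (|D| + 1) := by
        refine mul_le_mul hA ?_ dist_nonneg (by positivity)
        linarith [hD hy hz, le_abs_self D]
    _ < ρ := hk

theorem IsDiagonalAttractor.packingDim_eq [Finite ι] (h : IsDiagonalAttractor a b u v F) {s : ℝ}
    (hs : HasSepDim F s) : packingDim F = ENNReal.ofReal s := by
  refine le_antisymm (iSup₂_le fun t ht => ?_) (ENNReal.le_of_forall_nnreal_lt fun t ht => ?_)
  · by_contra! hlt
    rw [← ENNReal.ofReal_coe_nnreal, ENNReal.ofReal_lt_ofReal_iff'] at hlt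
    exact hs.packingMeasure_ne_top hlt.1 t.2 ht
  · refine le_iSup₂_of_le t (h.packingMeasure_eq_top hs ?_) le_rfl
    rw [← ENNReal.ofReal_coe_nnreal] at ht
    exact (ENNReal.ofReal_lt_ofReal_iff'.1 ht).1

end Packing

/-! ### Singular values of diagonal maps -/

section SingularValues

open Module.End in
/-- The singular values of `(p₀, p₁) ↦ (x p₀, y p₁)` are `|x|` and `|y|` in decreasing order. -/
lemma singularValues_diag {A : Module.End ℝ Plane} {x y : ℝ}
    (hA : ∀ p, A p = !₂[x * p 0, y * p 1]) :
    α₁ A = max |x| |y| ∧ α₂ A = min |x| |y| := by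
  have hA0 : ∀ p, A p 0 = x * p 0 := fun p => by rw [hA]; rfl
  have hA1 : ∀ p, A p 1 = y * p 1 := fun p => by rw [hA]; rfl
  have hsymm : LinearMap.adjoint A = A := by
    refine ((LinearMap.eq_adjoint_iff A A).2 fun p q => ?_).symm
    simp only [PiLp.inner_apply, Fin.sum_univ_two, hA0, hA1, RCLike.inner_apply, conj_trivial]
    ring
  have hn : Module.finrank ℝ Plane = 2 := by simp
  have hT0 : ∀ p, (LinearMap.adjoint A ∘ₗ A) p 0 = x ^ 2 * p 0 := fun p => by
    rw [hsymm, LinearMap.comp_apply, hA0, hA0]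
    ring
  have hT1 : ∀ p, (LinearMap.adjoint A ∘ₗ A) p 1 = y ^ 2 * p 1 := fun p => by
    rw [hsymm, LinearMap.comp_apply, hA1, hA1]
    ring
  have hval : ∀ n < 2, A.singularValues n ^ 2 = x ^ 2 ∨ A.singularValues n ^ 2 = y ^ 2 := by
    intro n h2
    obtain ⟨p, hp⟩ := (A.hasEigenvalue_adjoint_comp_self_sq_singularValues
      (hn ▸ h2)).exists_hasEigenvector
    have h3 := hp.apply_eq_smul
    have k0 := congrArg (fun q : Plane => q 0) h3
    have k1 := congrArg (fun q : Plane => q 1) h3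
    simp only [hT0, hT1, PiLp.smul_apply, smul_eq_mul] at k0 k1
    by_contra! hne
    refine hp.2 (Plane.ext ?_ ?_)
    · by_contra h0
      exact hne.1 (mul_right_cancel₀ h0 k0).symm
    · by_contra h0
      exact hne.2 (mul_right_cancel₀ h0 k1).symm
  have hex : ∀ μ, HasEigenvalue (LinearMap.adjoint A ∘ₗ A) μ →
      A.singularValues 0 ^ 2 = μ ∨ A.singularValues 1 ^ 2 = μ := by
    intro μ hμ
    obtain ⟨i, hi⟩ := A.isSymmetric_adjoint_comp_self.exists_eigenvalues_eq hn hμ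
    have hi' : A.singularValues i ^ 2 = μ := (A.sq_singularValues_fin hn i).trans hi
    fin_cases i
    · exact Or.inl hi'
    · exact Or.inr hi'
  have hx : HasEigenvalue (LinearMap.adjoint A ∘ₗ A) (x ^ 2) := by
    refine hasEigenvalue_of_hasEigenvector (x := !₂[1, 0]) ⟨mem_eigenspace_iff.2 ?_, ?_⟩
    · apply Plane.ext
      · rw [hT0]; simp
      · rw [hT1]; simp
    · intro h
      simpa using congrArg (fun q : Plane => q 0) h
  have hy : HasEigenvalue (LinearMap.adjoint A ∘ₗ A) (y ^ 2) := by
    refine hasEigenvalue_of_hasEigenvector (x := !₂[0, 1]) ⟨mem_eigenspace_iff.2 ?_, ?_⟩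
    · apply Plane.ext
      · rw [hT0]; simp
      · rw [hT1]; simp
    · intro h
      simpa using congrArg (fun q : Plane => q 1) h
  have hanti : A.singularValues 1 ≤ A.singularValues 0 := A.singularValues_antitone zero_le_one
  have hsq : ∀ n z, A.singularValues n ^ 2 = z ^ 2 ↔ A.singularValues n = |z| := fun n z => by
    rw [sq_eq_sq_iff_abs_eq_abs, abs_of_nonneg (A.singularValues_nonneg n)]
  have h0 := hval 0 (by norm_num)
  have h1 := hval 1 (by norm_num)
  have ex := hex _ hx
  have ey := hex _ hy
  simp only [hsq] at h0 h1 ex ey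
  unfold α₁ α₂
  rcases le_total |x| |y| with h | h
  · rw [max_eq_right h, min_eq_left h]
    constructor <;> grind
  · rw [max_eq_left h, min_eq_right h]
    constructor <;> grind

end SingularValues

/-! ### Box-like maps of separated type -/

section BoxLikeMaps

/-- A linear isometry which preserves the square `[-1, 1]²` acts on coordinates by signs, possibly
after interchanging them. -/
lemma isometry_square_cases (L : Plane ≃ₗᵢ[ℝ] Plane) (hL : L '' centredSquare = centredSquare) :
    ∃ σ τ : ℝ, |σ| = 1 ∧ |τ| = 1 ∧
      ((∀ p, L p 0 = σ * p 0 ∧ L p 1 = τ * p 1) ∨ (∀ p, L p 0 = σ * p 1 ∧ L p 1 = τ * p 0)) := by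
  have hsq : ∀ p ∈ centredSquare, L p ∈ centredSquare := fun p hp => hL ▸ mem_image_of_mem L hp
  have hnorm : ∀ p : Plane, L p 0 ^ 2 + L p 1 ^ 2 = p 0 ^ 2 + p 1 ^ 2 := by
    intro p
    have h1 := L.norm_map p
    have h2 := dist_sq_plane (L p) 0
    have h3 := dist_sq_plane p 0
    simp only [dist_zero_right, PiLp.zero_apply, sub_zero] at h2 h3
    rw [← h2, ← h3, h1]
  have hlin : ∀ p : Plane, ∀ j, L p j = p 0 * L !₂[1, 0] j + p 1 * L !₂[0, 1] j := by
    intro p j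
    have : p = p 0 • !₂[(1 : ℝ), 0] + p 1 • !₂[(0 : ℝ), 1] := by
      apply Plane.ext <;> simp
    conv_lhs => rw [this, map_add, map_smul, map_smul]
    simp
  have b1 := hsq !₂[1, 1] (by simp [centredSquare])
  have b2 := hsq !₂[1, -1] (by simp [centredSquare])
  have n1 := hnorm !₂[1, 1]
  have n2 := hnorm !₂[1, -1]
  have n3 := hnorm !₂[1, 0]
  have n4 := hnorm !₂[0, 1]
  obtain ⟨⟨b11, b12⟩, ⟨b13, b14⟩⟩ := b1
  obtain ⟨⟨b21, b22⟩, ⟨b23, b24⟩⟩ := b2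
  rw [hlin] at b11 b12 b13 b14 b21 b22 b23 b24
  rw [hlin !₂[1, 1] 0, hlin !₂[1, 1] 1] at n1
  rw [hlin !₂[1, -1] 0, hlin !₂[1, -1] 1] at n2
  set x := L !₂[1, 0] 0
  set y := L !₂[1, 0] 1
  set z := L !₂[0, 1] 0
  set w := L !₂[0, 1] 1
  simp at b11 b12 b13 b14 b21 b22 b23 b24 n1 n2 n3 n4
  -- The coordinates of the images of corners are `±1`, so `x * z` and `y * w` vanish.
  have hone : ∀ r t : ℝ, -1 ≤ r → r ≤ 1 → -1 ≤ t → t ≤ 1 → r ^ 2 + t ^ 2 = 2 →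
      r ^ 2 = 1 ∧ t ^ 2 = 1 := by
    intro r t h1 h2 h3 h4 h
    have k1 : r ^ 2 ≤ 1 := by rw [sq_le_one_iff_abs_le_one, abs_le]; exact ⟨h1, h2⟩
    have k2 : t ^ 2 ≤ 1 := by rw [sq_le_one_iff_abs_le_one, abs_le]; exact ⟨h3, h4⟩
    constructor <;> linarith
  obtain ⟨e1, e2⟩ := hone (x + z) (y + w) (by linarith) (by linarith) (by linarith) (by linarith)
    (by linear_combination n1)
  obtain ⟨e3, e4⟩ := hone (x - z) (y - w) (by linarith) (by linarith) (by linarith) (by linarith)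
    (by linear_combination n2)
  have exz : x * z = 0 := by linear_combination (e1 - e3) / 4
  have eyw : y * w = 0 := by linear_combination (e2 - e4) / 4
  have hxz : x ^ 2 + z ^ 2 = 1 := by linear_combination (e1 + e3) / 2
  have habs : ∀ r : ℝ, r ^ 2 = 1 → |r| = 1 := fun r hr => by
    rw [← sq_eq_sq₀ (abs_nonneg _) zero_le_one, sq_abs, hr, one_pow]
  rcases mul_eq_zero.1 exz with hx | hz
  · have hy : y ^ 2 = 1 := by rw [hx] at n3; linarith
    have hw : w = 0 := by
      rcases mul_eq_zero.1 eyw with h | h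
      · rw [h] at hy; norm_num at hy
      · exact h
    refine ⟨z, y, habs _ (by rw [hx] at hxz; linarith), habs _ hy, Or.inr fun p => ⟨?_, ?_⟩⟩
    · rw [hlin p 0]
      change p 0 * x + p 1 * z = _
      rw [hx]; ring
    · rw [hlin p 1]
      change p 0 * y + p 1 * w = _
      rw [hw]; ring
  · have hw : w ^ 2 = 1 := by rw [hz] at n4; linarith
    have hy : y = 0 := by
      rcases mul_eq_zero.1 eyw with h | h
      · exact h
      · rw [h] at hw; norm_num at hw
    refine ⟨x, w, habs _ (by rw [hz] at hxz; linarith), habs _ hw, Or.inl fun p => ⟨?_, ?_⟩⟩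
    · rw [hlin p 0]
      change p 0 * x + p 1 * z = _
      rw [hz]; ring
    · rw [hlin p 1]
      change p 0 * y + p 1 * w = _
      rw [hy]; ring

/-- A box-like map which does not send horizontal to vertical lines is diagonal. -/
lemma IsBoxLikeMap.exists_eq_diagMap {S : Plane →ᵃ[ℝ] Plane} (hS : IsBoxLikeMap S)
    (hsep : ¬ ∀ ℓ, IsHorizontalLine ℓ → IsVerticalLine (S '' ℓ)) :
    ∃ a b u v : ℝ, 0 < |b| ∧ |a| < 1 ∧ (∀ p, S p = diagMap a b u v p) := by
  obtain ⟨a, ⟨ha0, ha1⟩, b, ⟨hb0, hb1⟩, L, t, hL, hSp⟩ := hS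
  obtain ⟨σ, τ, hσ, hτ, h | h⟩ := isometry_square_cases L hL
  · refine ⟨a * σ, b * τ, t 0, t 1, ?_, ?_, fun p => ?_⟩
    · rw [abs_mul, hτ, mul_one]
      exact abs_pos.2 hb0.ne'
    · rwa [abs_mul, hσ, mul_one, abs_of_pos ha0]
    · rw [hSp]
      apply Plane.ext <;> simp [(h p).1, (h p).2] <;> ring
  · refine absurd ?_ hsep
    rintro _ ⟨c, rfl⟩
    have hτ0 : τ ≠ 0 := by
      rintro rfl
      simp at hτ
    have h0 : ∀ p, S p 0 = a * (σ * p 1) + t 0 := fun p => by rw [hSp, ← (h p).1]; simp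
    have h1 : ∀ p, S p 1 = b * (τ * p 0) + t 1 := fun p => by rw [hSp, ← (h p).2]; simp
    refine ⟨a * (σ * c) + t 0, Set.ext fun z => ⟨?_, fun hz => ?_⟩⟩
    · rintro ⟨p, hp, rfl⟩
      have hp' : p 1 = c := hp
      change S p 0 = _
      rw [h0, hp']
    · have hz' : z 0 = a * (σ * c) + t 0 := hz
      refine ⟨!₂[(z 1 - t 1) / (b * τ), c], by simp, Plane.ext ?_ ?_⟩
      · rw [h0, hz']
        simp
      · rw [h1]
        simp
        field_simp
        ring

lemma linear_eq_of_eq_diagMap {S : Plane →ᵃ[ℝ] Plane} {a b u v : ℝ}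
    (h : ∀ p, S p = diagMap a b u v p) (p : Plane) : S.linear p = !₂[a * p 0, b * p 1] := by
  have h1 : S.linear p = S p - S 0 := by
    have := S.linearMap_vsub p 0
    simpa using this
  rw [h1, h, h]
  apply Plane.ext <;> simp

end BoxLikeMaps

/-! ### The equation for the dimension -/

section Moran

variable {ι : Type*} [Fintype ι] {a b u v : ι → ℝ} {F : Set Plane}

lemma strictAnti_sum_rpow [Nonempty ι] (hb0 : ∀ i, 0 < |b i|) (hba : ∀ i, |b i| ≤ |a i|)
    (ha1 : ∀ i, |a i| < 1) (s₁ : ℝ) :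
    StrictAnti fun t : ℝ => ∑ i, |a i| ^ s₁ * |b i| ^ (t - s₁) := by
  intro t t' htt'
  refine Finset.sum_lt_sum_of_nonempty Finset.univ_nonempty fun i _ => ?_
  have h1 := hb0 i
  have h2 : 0 < |a i| := h1.trans_le (hba i)
  have h3 : |b i| < 1 := (hba i).trans_lt (ha1 i)
  exact mul_lt_mul_of_pos_left (Real.rpow_lt_rpow_of_exponent_gt h1 h3 (by linarith))
    (by positivity)

/-- The left-hand side is continuous and strictly decreasing in `t`, at least `2` at `t = 0`, and tends
to `0`. -/
lemma exists_moran (hι : 2 ≤ Fintype.card ι) (hb0 : ∀ i, 0 < |b i|) (hba : ∀ i, |b i| ≤ |a i|)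
    (ha1 : ∀ i, |a i| < 1) {s₁ : ℝ} (hs₁ : 0 ≤ s₁) :
    ∃ s : ℝ, 0 ≤ s ∧ ∀ t : ℝ, ∑ i, |a i| ^ s₁ * |b i| ^ (t - s₁) = 1 ↔ t = s := by
  have : Nonempty ι := Fintype.card_pos_iff.1 (by omega)
  set f : ℝ → ℝ := fun t => ∑ i, |a i| ^ s₁ * |b i| ^ (t - s₁) with hf
  have hanti : StrictAnti f := strictAnti_sum_rpow hb0 hba ha1 s₁
  have hcont : Continuous f := by
    refine continuous_finsetSum _ fun i _ => continuous_const.mul ?_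
    exact (Real.continuous_const_rpow (hb0 i).ne').comp (continuous_id.sub continuous_const)
  have h0 : 1 ≤ f 0 := by
    have h1 : ∑ _i : ι, (1 : ℝ) ≤ f 0 := by
      refine Finset.sum_le_sum fun i _ => ?_
      have h1 := hb0 i
      rw [zero_sub, Real.rpow_neg h1.le, ← div_eq_mul_inv, one_le_div (by positivity)]
      exact Real.rpow_le_rpow h1.le (hba i) hs₁
    have h2 : (2 : ℝ) ≤ Fintype.card ι := by exact_mod_cast hι
    simp only [Finset.sum_const, Finset.card_univ, nsmul_eq_mul, mul_one] at h1
    linarith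
  have hlim : Tendsto f atTop (𝓝 0) := by
    have : Tendsto f atTop (𝓝 (∑ i, |a i| ^ s₁ * 0)) := by
      refine tendsto_finsetSum _ fun i _ => Tendsto.const_mul _ ?_
      exact (tendsto_rpow_atTop_of_base_lt_one _ (by linarith [hb0 i])
        ((hba i).trans_lt (ha1 i))).comp (tendsto_atTop_add_const_right _ (-s₁) tendsto_id)
    simpa using this
  obtain ⟨T, hT1, hT0⟩ := ((hlim.eventually_lt_const one_pos).and (eventually_ge_atTop 0)).exists
  obtain ⟨s, hs, hfs⟩ := intermediate_value_Icc' hT0 hcont.continuousOn ⟨hT1.le, h0⟩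
  exact ⟨s, hs.1, fun t => ⟨fun ht => hanti.injective (ht.trans hfs.symm), fun ht => ht ▸ hfs⟩⟩

/-- The horizontal projection does not increase the dimension. -/
lemma HasSepDim.proj_le {s₁ s : ℝ} (h₁ : HasSepDim (π₁ '' F) s₁) (h : HasSepDim F s) : s₁ ≤ s := by
  refine le_of_forall_pos_le_add fun ε hε => ?_
  obtain ⟨c, hc, hL⟩ := h₁.lower (ε / 3) (by positivity)
  obtain ⟨C, hC, hU⟩ := h.upper (ε / 3) (by positivity)
  by_contra! hlt
  set e := s₁ - ε / 3 - (s + ε / 3) with he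
  have he0 : 0 < e := by linarith
  have hlim : Tendsto (fun δ : ℝ => c * (δ⁻¹) ^ e) (𝓝[>] 0) atTop :=
    ((tendsto_rpow_atTop he0).comp tendsto_inv_nhdsGT_zero).const_mul_atTop hc
  obtain ⟨δ, hδ, hδ0, hδ1⟩ := ((hlim.eventually_gt_atTop C).and
    (Ioc_mem_nhdsGT (zero_lt_one' ℝ))).exists
  obtain ⟨Q, hQ1, hQ2, hQ3⟩ := hL δ hδ0 hδ1
  have hpre : ∀ x : ℝ, ∃ p : Plane, x ∈ Q → p ∈ F ∧ p 0 = x := by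
    intro x
    by_cases hx : x ∈ Q
    · obtain ⟨p, hp, hpx⟩ := hQ1 hx
      exact ⟨p, fun _ => ⟨hp, hpx⟩⟩
    · exact ⟨0, fun h => absurd h hx⟩
  choose g hg using hpre
  obtain ⟨P, hP1, hP2, hP3⟩ := exists_separated_image (r := δ) hδ0.le (S := Q) (f := g) (by
    intro x hx y hy hne
    have h1 := abs_sub_zero_le_dist (g x) (g y)
    rw [(hg x hx).2, (hg y hy).2] at h1
    exact (hQ2 hx hy hne).trans_le h1)
  have h4 := hU δ hδ0 hδ1 P (by
    rw [hP1]
    rintro _ ⟨x, hx, rfl⟩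
    exact (hg x hx).1) hP2
  rw [hP3] at h4
  have h5 : δ ^ (-(s₁ - ε / 3)) = (δ⁻¹) ^ e * δ ^ (-(s + ε / 3)) := by
    rw [Real.inv_rpow hδ0.le, ← Real.rpow_neg hδ0.le, ← Real.rpow_add hδ0]
    congr 1
    rw [he]
    ring
  have h6 := hQ3.trans h4
  rw [h5, ← mul_assoc] at h6
  have := le_of_mul_le_mul_right h6 (by positivity)
  linarith

open MeasureTheory in
/-- Comparison of areas: the images of the rectangle are disjoint parts of it. -/
lemma sum_abs_mul_abs_le_one (S : ι → Plane →ᵃ[ℝ] Plane)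
    (hS : ∀ i p, S i p = diagMap (a i) (b i) (u i) (v i) p) (ha : ∀ i, a i ≠ 0)
    (hb : ∀ i, b i ≠ 0) (hR : ROSC S) :
    ∑ i, |a i| * |b i| ≤ 1 := by
  obtain ⟨a₀, b₀, c₀, d₀, hne, hsub, hdisj⟩ := hR
  set R := openRectangle a₀ b₀ c₀ d₀ with hRdef
  have hopen : IsOpen R :=
    (isOpen_Ioo.preimage (by fun_prop : Continuous fun p : Plane => p 0)).inter
      (isOpen_Ioo.preimage (by fun_prop : Continuous fun p : Plane => p 1))
  have hpos : volume R ≠ 0 := hopen.measure_ne_zero volume hne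
  have hfin : volume R ≠ ∞ := by
    refine (Metric.isBounded_iff.2 ⟨|b₀ - a₀| + |d₀ - c₀|, fun p hp q hq => ?_⟩).measure_lt_top.ne
    refine (dist_le_abs_add_abs p q).trans (add_le_add ?_ ?_)
    · exact (abs_le.2 ⟨by linarith [hp.1.1, hq.1.2], by linarith [hp.1.2, hq.1.1]⟩).trans
        (le_abs_self _)
    · exact (abs_le.2 ⟨by linarith [hp.2.1, hq.2.2], by linarith [hp.2.2, hq.2.1]⟩).trans
        (le_abs_self _)
  have hdet : ∀ i, LinearMap.det (S i).linear = a i * b i := by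
    intro i
    rw [← LinearMap.det_toMatrix (EuclideanSpace.basisFun (Fin 2) ℝ).toBasis, Matrix.det_fin_two]
    simp [LinearMap.toMatrix_apply, linear_eq_of_eq_diagMap (hS i)]
  have himg : ∀ i, S i '' R = (fun p => p + S i 0) '' ((S i).linear '' R) := by
    intro i
    rw [image_image]
    refine image_congr fun p _ => ?_
    have := (S i).linearMap_vsub p 0
    simp only [vsub_eq_sub, sub_zero] at this
    rw [this]
    abel
  have hvol : ∀ i, volume (S i '' R) = ENNReal.ofReal (|a i| * |b i|) * volume R := by
    intro i
    rw [himg, image_add_right, measure_preimage_add_right, Measure.addHaar_image_linearMap, hdet,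
      abs_mul]
  have hmeas : ∀ i, MeasurableSet (S i '' R) := by
    intro i
    have h : S i = diagMap (a i) (b i) (u i) (v i) := funext (hS i)
    rw [h]
    refine hopen.measurableSet.image_of_continuousOn_injOn (Continuous.continuousOn ?_)
      (diagMap_injective _ _ (ha i) (hb i)).injOn
    unfold diagMap
    fun_prop
  have h1 : ∑ i, volume (S i '' R) ≤ volume R := by
    have h := measure_iUnion (μ := volume) hdisj hmeas
    rw [tsum_fintype] at h
    rw [← h]
    exact measure_mono (iUnion_subset hsub)
  simp only [hvol] at h1
  rw [← Finset.sum_mul, ← ENNReal.ofReal_sum_of_nonneg fun i _ => by positivity] at h1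
  have h2 : ENNReal.ofReal (∑ i, |a i| * |b i|) * volume R ≤ 1 * volume R := by rwa [one_mul]
  rw [ENNReal.mul_le_mul_iff_left hpos hfin] at h2
  simpa using h2

end Moran

/-! ### Affinity dimension -/

section Affinity

variable {ι : Type*} {a b : ι → ℝ} {A : ι → Module.End ℝ Plane}

lemma wordProd_apply (hA : ∀ i p, A i p = !₂[a i * p 0, b i * p 1]) {k : ℕ} (w : Fin k → ι)
    (p : Plane) : wordProd A w p = !₂[(∏ j, a (w j)) * p 0, (∏ j, b (w j)) * p 1] := by
  have hlist : ∀ l : List ι, (l.map A).prod p = !₂[(l.map a).prod * p 0, (l.map b).prod * p 1] := by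
    intro l
    induction l with
    | nil => apply Plane.ext <;> simp
    | cons i l ih =>
      rw [List.map_cons, List.prod_cons, Module.End.mul_apply, ih, hA]
      apply Plane.ext <;> simp [mul_assoc]
  have := hlist (List.ofFn w)
  simp only [List.map_ofFn, List.prod_ofFn] at this
  exact this

lemma alpha_wordProd (hA : ∀ i p, A i p = !₂[a i * p 0, b i * p 1]) (hba : ∀ i, |b i| ≤ |a i|)
    {k : ℕ} (w : Fin k → ι) :
    α₁ (wordProd A w) = ∏ j, |a (w j)| ∧ α₂ (wordProd A w) = ∏ j, |b (w j)| := by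
  have h := singularValues_diag (wordProd_apply hA w)
  have hle : ∏ j, |b (w j)| ≤ ∏ j, |a (w j)| :=
    Finset.prod_le_prod (fun _ _ => abs_nonneg _) fun j _ => hba (w j)
  rwa [Finset.abs_prod, Finset.abs_prod, max_eq_left hle, min_eq_right hle] at h

/-- Because the maps are simultaneously diagonal with the same dominating direction, the singular
value function is multiplicative on words. -/
lemma singularValueFunction_wordProd (hA : ∀ i p, A i p = !₂[a i * p 0, b i * p 1])
    (hba : ∀ i, |b i| ≤ |a i|) (t : ℝ) {k : ℕ} (w : Fin k → ι) :
    singularValueFunction t (wordProd A w) = ∏ j, singularValueFunction t (A (w j)) := by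
  have h1 : ∀ i, α₁ (A i) = |a i| ∧ α₂ (A i) = |b i| := fun i => by
    have := singularValues_diag (hA i)
    rwa [max_eq_left (hba i), min_eq_right (hba i)] at this
  unfold singularValueFunction
  obtain ⟨h2, h3⟩ := alpha_wordProd hA hba w
  simp only [h2, h3, (h1 _).1, (h1 _).2]
  split_ifs
  · rw [Real.finsetProd_rpow _ _ fun _ _ => abs_nonneg _]
  · rw [Finset.prod_mul_distrib, Real.finsetProd_rpow _ _ fun _ _ => abs_nonneg _]
  · rw [Real.finsetProd_rpow _ _ fun _ _ => by positivity, Finset.prod_mul_distrib]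

lemma singularValueFunction_nonneg (t : ℝ) (A : Module.End ℝ Plane) :
    0 ≤ singularValueFunction t A := by
  have h1 : 0 ≤ α₁ A := A.singularValues_nonneg 0
  have h2 : 0 ≤ α₂ A := A.singularValues_nonneg 1
  unfold singularValueFunction
  split_ifs <;> positivity

lemma sum_words_lt_top_iff [Fintype ι] (hA : ∀ i p, A i p = !₂[a i * p 0, b i * p 1])
    (hba : ∀ i, |b i| ≤ |a i|) (t : ℝ) :
    ∑' k : ℕ, ∑ w : Fin (k + 1) → ι, ENNReal.ofReal (singularValueFunction t (wordProd A w)) < ∞ ↔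
      ∑ i, singularValueFunction t (A i) < 1 := by
  set σ := ∑ i, singularValueFunction t (A i) with hσ
  have hσ0 : 0 ≤ σ := Finset.sum_nonneg fun i _ => singularValueFunction_nonneg t _
  have h1 : ∀ k : ℕ, ∑ w : Fin (k + 1) → ι,
      ENNReal.ofReal (singularValueFunction t (wordProd A w)) = ENNReal.ofReal σ ^ (k + 1) := by
    intro k
    rw [← ENNReal.ofReal_sum_of_nonneg fun w _ => singularValueFunction_nonneg t _]
    simp only [singularValueFunction_wordProd hA hba]
    rw [← Fintype.sum_pow fun i => singularValueFunction t (A i), ENNReal.ofReal_pow hσ0]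
  simp only [h1]
  constructor
  · intro h
    by_contra! hge
    refine h.ne (top_unique ?_)
    rw [← ENNReal.tsum_const_eq_top_of_ne_zero (α := ℕ) one_ne_zero]
    exact ENNReal.tsum_le_tsum fun k => one_le_pow₀ (by simpa using hge)
  · intro h
    simp only [pow_succ]
    rw [ENNReal.tsum_mul_right, ENNReal.tsum_geometric]
    refine ENNReal.mul_lt_top ?_ ENNReal.ofReal_lt_top
    rw [ENNReal.inv_lt_top, tsub_pos_iff_lt]
    simpa using h

/-- For diagonal maps the affinity dimension is the solution of
`∑ α₁ α₂ ^ (s - 1) = 1`, provided that this solution lies in `[1, 2]`. -/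
theorem affinityDim_eq (hA : ∀ i p, A i p = !₂[a i * p 0, b i * p 1]) [Fintype ι] [Nonempty ι]
    (hb0 : ∀ i, 0 < |b i|) (hba : ∀ i, |b i| ≤ |a i|) (ha1 : ∀ i, |a i| < 1)
    (harea : ∑ i, |a i| * |b i| ≤ 1) {s : ℝ} (hs1 : 1 ≤ s)
    (hs : ∑ i, |a i| ^ (1 : ℝ) * |b i| ^ (s - 1) = 1) : affinityDim A = ENNReal.ofReal s := by
  have h1 : ∀ i, α₁ (A i) = |a i| ∧ α₂ (A i) = |b i| := fun i => by
    have := singularValues_diag (hA i)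
    rwa [max_eq_left (hba i), min_eq_right (hba i)] at this
  have hb1 : ∀ i, |b i| ≤ 1 := fun i => (hba i).trans (ha1 i).le
  have hanti := strictAnti_sum_rpow hb0 hba ha1 1
  simp only [Real.rpow_one] at hanti
  have hs' : ∑ i, |a i| * |b i| ^ (s - 1) = 1 := by simpa only [Real.rpow_one] using hs
  have hs2 : s ≤ 2 := by
    by_contra! hlt
    have := hanti hlt
    simp only [hs', show (2 : ℝ) - 1 = 1 by norm_num, Real.rpow_one] at this
    linarith
  refine le_antisymm (le_of_forall_gt_imp_ge_of_dense fun c hc => ?_) (le_iInf₂ fun t ht => ?_)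
  · induction c with
    | top => exact le_top
    | coe t =>
      rw [← ENNReal.ofReal_coe_nnreal] at hc
      have hst : s < t := (ENNReal.ofReal_lt_ofReal_iff'.1 hc).1
      refine iInf₂_le_of_le t ((sum_words_lt_top_iff hA hba t).2 ?_) le_rfl
      simp only [singularValueFunction, (h1 _).1, (h1 _).2, not_le.2 (hs1.trans_lt hst), if_false]
      split_ifs with h2
      · have := hanti hst
        simpa only [hs'] using this
      · refine lt_of_lt_of_le (Finset.sum_lt_sum_of_nonempty Finset.univ_nonempty fun i _ => ?_)
          harea
        have hb := hb0 i
        have ha := hb.trans_le (hba i)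
        have hlt : |a i| * |b i| < 1 := by nlinarith [ha1 i, hb1 i]
        calc (|a i| * |b i|) ^ ((t : ℝ) / 2) < (|a i| * |b i|) ^ (1 : ℝ) :=
              Real.rpow_lt_rpow_of_exponent_gt (by positivity) hlt (by linarith)
          _ = _ := Real.rpow_one _
  · rw [sum_words_lt_top_iff hA hba] at ht
    by_contra! hlt
    rw [← ENNReal.ofReal_coe_nnreal] at hlt
    have hts : (t : ℝ) < s := (ENNReal.ofReal_lt_ofReal_iff'.1 hlt).1
    refine absurd ht (not_lt.2 ?_)
    simp only [singularValueFunction, (h1 _).1, (h1 _).2]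
    split_ifs with h2 h3
    · rw [← hs]
      refine Finset.sum_le_sum fun i _ => ?_
      have hb := hb0 i
      have ha := hb.trans_le (hba i)
      calc |a i| ^ (1 : ℝ) * |b i| ^ (s - 1) ≤ |a i| ^ (1 : ℝ) * 1 := by
            gcongr
            exact Real.rpow_le_one hb.le (hb1 i) (by linarith)
        _ ≤ |a i| ^ (t : ℝ) := by
            rw [mul_one]
            exact Real.rpow_le_rpow_of_exponent_ge ha (ha1 i).le h2
    · have := hanti hts
      simp only [hs'] at this
      exact this.le
    · linarith

end Affinity

end BoxLike

theorem mainTheorem2 {ι : Type*} [Fintype ι] (hι : 2 ≤ Fintype.card ι)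
    (S : ι → BoxLike.Plane →ᵃ[ℝ] BoxLike.Plane)
    (hS : ∀ i, BoxLike.IsBoxLikeMap (S i))
    (F : Set BoxLike.Plane) (hF : BoxLike.IsAttractor S F)
    (hsep : BoxLike.IsSeparatedType S)
    (hROSC : BoxLike.ROSC S)
    (hhor : ∀ i, BoxLike.LargerSingularValueHorizontal (S i).linear) :
    ∃ s₁ s : ℝ,
      BoxLike.HasBoxDim (BoxLike.π₁ '' F) s₁ ∧
      0 ≤ s ∧
      (∀ t : ℝ, ∑ i, BoxLike.α₁ (S i).linear ^ s₁ * BoxLike.α₂ (S i).linear ^ (t - s₁) = 1 ↔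
        t = s) ∧
      BoxLike.packingDim F = ENNReal.ofReal s ∧
      BoxLike.HasBoxDim F s ∧
      (s₁ = 1 → BoxLike.affinityDim (fun i => (S i).linear) = ENNReal.ofReal s) := by
  open BoxLike in
  have hdiag : ∀ i, ∃ a b u v : ℝ, 0 < |b| ∧ |a| < 1 ∧ ∀ p, S i p = diagMap a b u v p :=
    fun i => (hS i).exists_eq_diagMap fun h => eq_empty_iff_forall_notMem.1 hsep i h
  choose a b u v hb0 ha1 hSi using hdiag
  have hlin : ∀ i p, (S i).linear p = !₂[a i * p 0, b i * p 1] :=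
    fun i p => linear_eq_of_eq_diagMap (hSi i) p
  have hba : ∀ i, |b i| ≤ |a i| := by
    intro i
    have h1 := hhor i 1
    rw [hlin, (singularValues_diag (hlin i)).1] at h1
    have h2 : |a i| = max |a i| |b i| := by
      simpa [EuclideanSpace.norm_eq, Fin.sum_univ_two, Real.sqrt_sq_eq_abs] using h1
    exact h2 ▸ le_max_right _ _
  have hα : ∀ i, α₁ (S i).linear = |a i| ∧ α₂ (S i).linear = |b i| := fun i => by
    have := singularValues_diag (hlin i)
    rwa [max_eq_left (hba i), min_eq_right (hba i)] at this
  have hcoe : ∀ i, (S i : Plane → Plane) = diagMap (a i) (b i) (u i) (v i) :=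
    fun i => funext (hSi i)
  have hatt : IsDiagonalAttractor a b u v F :=
    ⟨hb0, hba, ha1, hF.1, hF.2.1, by simpa only [hcoe] using hF.2.2⟩
  have hne := hatt.index_nonempty
  obtain ⟨s₁, hs₁0, hs₁⟩ := hatt.exists_hasSepDim_proj
  obtain ⟨s, hs0, hs⟩ := exists_moran hι hb0 hba ha1 hs₁0
  have harea := sum_abs_mul_abs_le_one S hSi
    (fun i => abs_pos.1 ((hb0 i).trans_le (hba i))) (fun i => abs_pos.1 (hb0 i)) hROSC
  obtain ⟨a₀, b₀, c₀, d₀, hRne, hR, hdisj⟩ := hROSC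
  simp only [hcoe] at hR hdisj
  have hdim : HasSepDim F s := hatt.hasSepDim hRne hR hdisj hs₁ ((hs s).2 rfl)
  refine ⟨s₁, s, hs₁.hasBoxDim (hatt.nonempty.image _), hs0, ?_, hatt.packingDim_eq hdim,
    hdim.hasBoxDim hatt.nonempty, ?_⟩
  · simpa only [(hα _).1, (hα _).2] using hs
  · rintro rfl
    exact affinityDim_eq hlin hb0 hba ha1 harea (hs₁.proj_le hdim) ((hs s).2 rfl)
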